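/- Let $f=\frac1N\sum_{i=1}^N f_i$ with $N=mn$, where each $f_i:\mathbb R^d\to\mathbb R$ is convex and differentiable with $L$-Lipschitz gradient ($L>0$), and let $f$ be $\mu$-strongly convex, i.e. $\|\nabla f(x)-\nabla f(y)\|\ge\mu\|x-y\|$ for all $x,y$ ($\mu>0$). Let $x^*$ be the minimizer of $f$, let $\sigma\ge 0$, and put $q=\frac{\mu}{\mu+\sigma}$, $f_\sigma(x;y)=f(x)+\frac\sigma2\|x-y\|^2=\frac1N\sum_i\tilde f_i(x;y)$, $\tilde f_i(x;y)=f_i(x)+\frac{\sigma}{2}\|x-y\|^2$, $\kappa(f_\sigma)=\frac{L+\sigma}{\mu+\sigma}$. Each of $m$ machines can store $C>n$ functions; write $\tilde n=C-n$. DASVRG with parameters $\eta,T,K,P$, $Q=TKP\le\tilde n m$, and initial point $\hat x_0$: *Data allocation.* Draw a uniformly random permutation $i_1,\dots,i_N$ of $[N]$ and let $S_j=\{i_{(j-1)n+1},\dots,i_{jn}\}$. For $\ell=1,\dots,Q$, independently, let $u_\ell$ be uniform on $[N]$, and put $r_\ell=i_\ell$ if $u_\ell\ge\ell$ and $r_\ell=i_{u_\ell}$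 if $u_\ell<\ell$. Let $R_j$ be the multiset of the $r_\ell$ with $(j-1)\tilde n<\ell\le\min(j\tilde n,Q)$. Machine $k=1$ is active at the start. *Outer iterations.* Let $y_0=\hat x_0$, $\alpha_0=\sqrt q$. For $p=1,\dots,P$: start from $\tilde x^0=\hat x_{p-1}$ and perform $K$ stages. In stage $\ell$ compute $h^\ell=\frac1N\sum_{j=1}^m\sum_{i\in S_j}\nabla\tilde f_i(\tilde x^\ell;y_{p-1})$ and, from $x_0=\tilde x^\ell$, perform $T$ updates $x_{t+1}=x_t-\eta\big(\nabla\tilde f_i(x_t;y_{p-1})-\nabla\tilde f_i(\tilde x^\ell;y_{p-1})+h^\ell\big)$, where $i$ is drawn uniformly from the current multiset $R_k$ of the active machine $k$ and then removed from it, and machine $k+1$ becomes active when $R_k$ becomes empty; put $\tilde x^{\ell+1}=\frac1T\sum_{t=1}^Tx_t$. After the stages let $\hat x_p=\tilde x^K$, let $\alpha_p>0$ solve $\alpha_p^2=(1-\alpha_p)\alpha_{p-1}^2+q\alpha_p$, and set $y_p=\hat x_p+\beta_p(\hat x_p-\hat x_{p-1})$, $\beta_p=\frac{\alpha_{p-1}(1-\alpha_{p-1})}{\alpha_{p-1}^2+\alpha_p}$.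 **Proposition.** Suppose that either $\eta=\frac1{16L}$ and $\sigma\le 15L$, or $\eta=\frac{1}{16(L+\sigma)}$, and that $$T=\lceil 96\,\kappa(f_\sigma)\rceil,\qquad K=\left\lceil\frac{1}{\log(9/8)}\log\left(\frac{4}{2-\sqrt q}+\frac{10368\,\sigma}{\mu q(1-\frac{\sqrt q}{2})^2}\right)\right\rceil .$$ There is an absolute constant $c>0$ such that the following hold. 1. $K\le c\,(1+\log(1+\sigma/\mu))$ always, and $K\le c\log(1+\sigma/\mu)$ whenever $\sigma\ge\mu$. 2. For every $P$ with $TKP=Q\le\tilde n m$ and every $p=1,\dots,P$, the iterate $\hat x_p$ satisfies $$\mathbb E\Big[f_\sigma(\hat x_p;y_{p-1})-\min_{x}f_\sigma(x;y_{p-1})\Big]\le\frac29\,[f(\hat x_0)-f(x^*)]\Big(1-\frac{\sqrt q}{2}\Big)^p .$$ 3. Let $\epsilon>0$ and let $P$ satisfy $TKP=Q\le\tilde n m$. Then $\mathbb E[f(\hat x_P)-f(x^*)]\le\epsilon$ as soon as $P\ge c\sqrt{\frac{\mu+\sigma}{\mu}}\,\log\left(\frac{c(\mu+\sigma)[f(\hat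 x_0)-f(x^*)]}{\mu\,\epsilon}\right)$ (with no further condition on $P$ if $f(\hat x_0)=f(x^*)$). In particular $P=O\big(\sqrt{(\mu+\sigma)/\mu}\,\log(1/\epsilon)\big)$ outer iterations suffice for small $\epsilon$: if $\epsilon\le\frac12$ and $\epsilon\,(1+f(\hat x_0)-f(x^*))\le\frac{\mu}{\mu+\sigma}$, then $\mathbb E[f(\hat x_P)-f(x^*)]\le\epsilon$ as soon as $P\ge c\sqrt{\frac{\mu+\sigma}{\mu}}\,\log\frac1\epsilon$. -/

import Mathlib

noncomputable section

namespace DASVRG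

/-- `ℝ^d` with the Euclidean norm. -/
abbrev Vec (d : ℕ) : Type := EuclideanSpace ℝ (Fin d)

/-- `g` is `L`-smooth: differentiable with an `L`-Lipschitz gradient. -/
def IsSmooth {d : ℕ} (L : ℝ) (g : Vec d → ℝ) : Prop :=
  Differentiable ℝ g ∧ ∀ x y : Vec d, ‖gradient g x - gradient g y‖ ≤ L * ‖x - y‖

/-- The gradient condition `‖∇g(x) - ∇g(y)‖ ≥ μ ‖x - y‖`, which for convex smooth `g` is
`μ`-strong convexity. -/
def GradExpanding {d : ℕ} (μ : ℝ) (g : Vec d → ℝ) : Prop :=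
  ∀ x y : Vec d, μ * ‖x - y‖ ≤ ‖gradient g x - gradient g y‖

/-- The objective `f(x) = (1/N) ∑ i, f_i(x)`. -/
def objective {N d : ℕ} (f : Fin N → Vec d → ℝ) (x : Vec d) : ℝ :=
  (1 / (N : ℝ)) * ∑ i, f i x

/-- The components `f_i(x) + (σ/2) ‖x - y‖²` of the proximal function with proximal point `y`. -/
def proxComponent {N d : ℕ} (f : Fin N → Vec d → ℝ) (σ : ℝ) (y : Vec d) (i : Fin N)
    (x : Vec d) : ℝ :=
  f i x + σ / 2 * ‖x - y‖ ^ 2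

/-- The proximal function `f_σ(x; y) = f(x) + (σ/2) ‖x - y‖²`. -/
def proxObjective {N d : ℕ} (f : Fin N → Vec d → ℝ) (σ : ℝ) (x y : Vec d) : ℝ :=
  objective f x + σ / 2 * ‖x - y‖ ^ 2

/-- The optimal value `min_x f_σ(x; y)` of the proximal problem with proximal point `y`. -/
def proxMin {N d : ℕ} (f : Fin N → Vec d → ℝ) (σ : ℝ) (y : Vec d) : ℝ :=
  ⨅ x : Vec d, proxObjective f σ x y

/-! ### Parameters of the method -/

/-- `q = μ / (μ + σ)`. -/
def ratio (μ σ : ℝ) : ℝ := μ / (μ + σ)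

/-- The condition number `κ(f_σ) = (L + σ) / (μ + σ)` of the proximal function. -/
def proxCond (L μ σ : ℝ) : ℝ := (L + σ) / (μ + σ)

/-- The number of iterative updates in a stage, `T = 96 κ(f_σ)`, rounded up. -/
def stageLength (L μ σ : ℝ) : ℕ := ⌈96 * proxCond L μ σ⌉₊

/-- The number of stages in an outer iteration,
`K = log (4 / (2 - √q) + 10368 σ / (μ q (1 - √q/2)²)) / log (9/8)`, rounded up. -/
def numStages (μ σ : ℝ) : ℕ :=
  ⌈1 / Real.log (9 / 8) *
    Real.log (4 / (2 - √(ratio μ σ)) +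
      10368 * σ / (μ * ratio μ σ * (1 - √(ratio μ σ) / 2) ^ 2))⌉₊

/-- The positive root `b` of `b² = (1 - b) a² + q b`. -/
def posRoot (q a : ℝ) : ℝ := ((q - a ^ 2) + √((q - a ^ 2) ^ 2 + 4 * a ^ 2)) / 2

/-- `α_0 = √q`, and `α_{p+1}` is determined by `α_{p+1}² = (1 - α_{p+1}) α_p² + q α_{p+1}`. -/
def alpha (q : ℝ) : ℕ → ℝ
  | 0 => √q
  | p + 1 => posRoot q (alpha q p)

/-- The extrapolation step length `β_{p+1} = α_p (1 - α_p) / (α_p² + α_{p+1})`, indexed so that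
`betaNext q p` is `β_{p+1}`. -/
def betaNext (q : ℝ) (p : ℕ) : ℝ :=
  alpha q p * (1 - alpha q p) / (alpha q p ^ 2 + alpha q (p + 1))

theorem posRoot_eq (q a : ℝ) :
    posRoot q a ^ 2 = (1 - posRoot q a) * a ^ 2 + q * posRoot q a := by
  have h : √((q - a ^ 2) ^ 2 + 4 * a ^ 2) ^ 2 = (q - a ^ 2) ^ 2 + 4 * a ^ 2 :=
    Real.sq_sqrt (by positivity)
  unfold posRoot
  nlinarith [h]

theorem posRoot_pos (q a : ℝ) (ha : a ≠ 0) : 0 < posRoot q a := by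
  have h : |q - a ^ 2| < √((q - a ^ 2) ^ 2 + 4 * a ^ 2) := by
    rw [← Real.sqrt_sq_eq_abs]
    have : 0 < a ^ 2 := by positivity
    exact Real.sqrt_lt_sqrt (sq_nonneg _) (by linarith)
  unfold posRoot
  linarith [neg_abs_le (q - a ^ 2)]

theorem posRoot_lt_one (q a : ℝ) (ha : a ≠ 0) (hq : q < 1) : posRoot q a < 1 := by
  have h1 := posRoot_eq q a
  have h2 := posRoot_pos q a ha
  by_contra hc
  have hc1 : 1 ≤ posRoot q a := not_lt.mp hc
  nlinarith [mul_nonneg (sub_nonneg.mpr hc1) (sq_nonneg a),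
    mul_nonneg (sub_nonneg.mpr hc1) h2.le, mul_pos (sub_pos.mpr hq) h2]

/-- The positive root is unique. -/
theorem eq_posRoot (q a b : ℝ) (ha : a ≠ 0) (hb : 0 < b)
    (h : b ^ 2 = (1 - b) * a ^ 2 + q * b) : b = posRoot q a := by
  have h1 := posRoot_eq q a
  have h2 := posRoot_pos q a ha
  have ha2 : 0 < a ^ 2 := by positivity
  have h3 : (b - posRoot q a) * (b * posRoot q a + a ^ 2) = 0 := by
    linear_combination posRoot q a * h - b * h1
  have h4 : b * posRoot q a + a ^ 2 ≠ 0 := by positivity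
  have h5 := (mul_eq_zero.mp h3).resolve_right h4
  linarith

/-! ### Data allocation

Indices of functions, machines and sample positions start at `0`. -/

/-- The output of the data allocation: the sets `S_j` (`part j`) and the multisets `R_j`
(`samples j`) of the machines `j = 0, …, m - 1`. -/
structure Allocation (N : ℕ) where
  part : ℕ → Finset (Fin N)
  samples : ℕ → Multiset (Fin N)

/-- `S_j`: the `j`-th block of `n` consecutive entries of the permutation `π`. -/
def partSet {N : ℕ} (n : ℕ) (π : Equiv.Perm (Fin N)) (j : ℕ) : Finset (Fin N) :=
  (Finset.univ.filter fun l : Fin N => (l : ℕ) / n = j).map π.toEmbedding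

/-- The index `r_l` built from the permutation `π` and a uniform `u_l`: it is `π l` if `l ≤ u_l`
(probability `1 - l/N` for `l < N`) and `π l'` if `u_l = l' < l` (probability `1/N` each). -/
def sampleIndex {N Q : ℕ} (π : Equiv.Perm (Fin N)) (u : Fin Q → Fin N) (l : Fin Q) : Fin N :=
  if h : (l : ℕ) ≤ (u l : ℕ) then π ⟨l, lt_of_le_of_lt h (u l).isLt⟩ else π (u l)

/-- `R_j`: the multiset formed by the `j`-th block of `nt` consecutive indices among
`r_0, …, r_{Q-1}` (the last nonempty block may be shorter, and later blocks are empty). -/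
def sampleSet {N Q : ℕ} (nt : ℕ) (r : Fin Q → Fin N) (j : ℕ) : Multiset (Fin N) :=
  (Finset.univ.filter fun l : Fin Q => (l : ℕ) / nt = j).val.map r

/-- The law of the output of the data allocation procedure `DA(N, m, Q)`, where `n = N / m` is
the size of the sets `S_j` and `nt` is the remaining space on each machine. -/
def dataAllocation (N : ℕ) [NeZero N] (n nt Q : ℕ) : PMF (Allocation N) :=
  (PMF.uniformOfFintype (Equiv.Perm (Fin N))).bind fun π =>
    (PMF.uniformOfFintype (Fin Q → Fin N)).map fun u =>
      { part := partSet n π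
        samples := sampleSet nt (sampleIndex π u) }

/-! ### Single-stage SVRG -/

/-- State inside a stage: the iterate `x_t`, the running average of `x_1, …, x_t`, the remaining
multisets `R_j`, and the active machine `k`. -/
structure InnerState (N d : ℕ) where
  x : Vec d
  xbar : Vec d
  R : ℕ → Multiset (Fin N)
  k : ℕ

/-- Iterative update number `t`, for component functions `g`, reference point `xt` and batch
gradient `h`: the active machine samples `i` from its multiset `R_k`, updates the iterate and the
running average and removes `i` from `R_k`; if `R_k` has become empty, the next machine becomes
active. (With nothing left to sample the state does not change.) -/
def innerStep {N d : ℕ} (g : Fin N → Vec d → ℝ) (η : ℝ) (xt h : Vec d) (t : ℕ)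
    (s : InnerState N d) : PMF (InnerState N d) :=
  if hR : s.R s.k = 0 then PMF.pure s
  else (PMF.ofMultiset (s.R s.k) hR).map fun i =>
    let xn : Vec d := s.x - η • (gradient (g i) s.x - gradient (g i) xt + h)
    let Rk : Multiset (Fin N) := (s.R s.k).erase i
    { x := xn
      xbar := (1 / ((t : ℝ) + 1)) • (xn + (t : ℝ) • s.xbar)
      R := Function.update s.R s.k Rk
      k := if Rk = 0 then s.k + 1 else s.k }

/-- The law of the state after `t` iterative updates of a stage. -/
def innerLoop {N d : ℕ} (g : Fin N → Vec d → ℝ) (η : ℝ) (xt h : Vec d)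
    (R : ℕ → Multiset (Fin N)) (k : ℕ) : ℕ → PMF (InnerState N d)
  | 0 => PMF.pure { x := xt, xbar := 0, R := R, k := k }
  | t + 1 => (innerLoop g η xt h R k t).bind (innerStep g η xt h t)

/-- State between stages: the reference point, the remaining multisets, the active machine. -/
structure StageState (N d : ℕ) where
  x : Vec d
  R : ℕ → Multiset (Fin N)
  k : ℕ

/-- `SS-SVRG`: `T` iterative updates, returning the average of `x_1, …, x_T`. -/
def ssSVRG {N d : ℕ} (g : Fin N → Vec d → ℝ) (η : ℝ) (T : ℕ) (h : Vec d)
    (s : StageState N d) : PMF (StageState N d) :=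
  (innerLoop g η s.x h s.R s.k T).map fun r => { x := r.xbar, R := r.R, k := r.k }

/-- The batch gradient at `x`, assembled from the contributions of the `m` machines. -/
def batchGradient {N d : ℕ} (m : ℕ) (S : ℕ → Finset (Fin N)) (g : Fin N → Vec d → ℝ)
    (x : Vec d) : Vec d :=
  (1 / (N : ℝ)) • ∑ j ∈ Finset.range m, ∑ i ∈ S j, gradient (g i) x

/-- The law of the state after the given number of stages. -/
def stageLoop {N d : ℕ} (m : ℕ) (S : ℕ → Finset (Fin N)) (g : Fin N → Vec d → ℝ) (η : ℝ)
    (T : ℕ) (s : StageState N d) : ℕ → PMF (StageState N d)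
  | 0 => PMF.pure s
  | l + 1 => (stageLoop m S g η T s l).bind fun r =>
      ssSVRG g η T (batchGradient m S g r.x) r

/-! ### The accelerated method -/

/-- State after `p` outer iterations: `xhat` is `x̂_p`, `y` is `y_p`, and `yPrev` is the proximal
point `y_{p-1}` that was used in the `p`-th outer iteration (the initial point if `p = 0`). -/
structure OuterState (N d : ℕ) where
  xhat : Vec d
  y : Vec d
  yPrev : Vec d
  R : ℕ → Multiset (Fin N)
  k : ℕ

/-- The law of the state after the given number of outer iterations, for a given allocation. -/
def outerLoop {N d : ℕ} (f : Fin N → Vec d → ℝ) (μ σ η : ℝ) (m T K : ℕ) (x0 : Vec d)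
    (A : Allocation N) : ℕ → PMF (OuterState N d)
  | 0 => PMF.pure { xhat := x0, y := x0, yPrev := x0, R := A.samples, k := 0 }
  | p + 1 => (outerLoop f μ σ η m T K x0 A p).bind fun s =>
      (stageLoop m A.part (proxComponent f σ s.y) η T { x := s.xhat, R := s.R, k := s.k } K).map
        fun r =>
          { xhat := r.x
            y := r.x + betaNext (ratio μ σ) p • (r.x - s.xhat)
            yPrev := s.y
            R := r.R
            k := r.k }

/-- The law of the state of DASVRG after `p` outer iterations, in a run in which `Q` indices were
sampled in advance. -/
def run {N d : ℕ} [NeZero N] (f : Fin N → Vec d → ℝ) (μ σ η : ℝ) (m n nt T K Q : ℕ)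
    (x0 : Vec d) (p : ℕ) : PMF (OuterState N d) :=
  (dataAllocation N n nt Q).bind fun A => outerLoop f μ σ η m T K x0 A p

/-- Expectation of a real function under a discrete law. All laws here have finite support
(`run_support_finite`), so that the sum is a finite one. -/
def expect {α : Type} (p : PMF α) (g : α → ℝ) : ℝ := ∑' a, (p a).toReal * g a

theorem finite_support_bind {α β : Type} (p : PMF α) (g : α → PMF β) (hp : p.support.Finite)
    (hg : ∀ a, (g a).support.Finite) : (p.bind g).support.Finite := by
  rw [PMF.support_bind]
  exact hp.biUnion fun a _ => hg a

theorem finite_support_map {α β : Type} (p : PMF α) (g : α → β) (hp : p.support.Finite) :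
    (p.map g).support.Finite := by
  rw [PMF.support_map]
  exact hp.image g

theorem finite_support_pure {α : Type} (a : α) : (PMF.pure a).support.Finite := by
  rw [PMF.support_pure]
  exact Set.finite_singleton a

theorem innerLoop_support_finite {N d : ℕ} (g : Fin N → Vec d → ℝ) (η : ℝ) (xt h : Vec d)
    (R : ℕ → Multiset (Fin N)) (k t : ℕ) : (innerLoop g η xt h R k t).support.Finite := by
  induction t with
  | zero => exact finite_support_pure _
  | succ t ih =>
    refine finite_support_bind _ _ ih fun s => ?_
    unfold innerStep
    split_ifs
    · exact finite_support_pure _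
    · exact finite_support_map _ _ (Set.toFinite _)

theorem stageLoop_support_finite {N d : ℕ} (m : ℕ) (S : ℕ → Finset (Fin N))
    (g : Fin N → Vec d → ℝ) (η : ℝ) (T : ℕ) (s : StageState N d) (l : ℕ) :
    (stageLoop m S g η T s l).support.Finite := by
  induction l with
  | zero => exact finite_support_pure _
  | succ l ih =>
    exact finite_support_bind _ _ ih fun r =>
      finite_support_map _ _ (innerLoop_support_finite _ _ _ _ _ _ _)

theorem outerLoop_support_finite {N d : ℕ} (f : Fin N → Vec d → ℝ) (μ σ η : ℝ) (m T K : ℕ)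
    (x0 : Vec d) (A : Allocation N) (p : ℕ) :
    (outerLoop f μ σ η m T K x0 A p).support.Finite := by
  induction p with
  | zero => exact finite_support_pure _
  | succ p ih =>
    exact finite_support_bind _ _ ih fun s =>
      finite_support_map _ _ (stageLoop_support_finite _ _ _ _ _ _ _)

theorem run_support_finite {N d : ℕ} [NeZero N] (f : Fin N → Vec d → ℝ) (μ σ η : ℝ)
    (m n nt T K Q : ℕ) (x0 : Vec d) (p : ℕ) :
    (run f μ σ η m n nt T K Q x0 p).support.Finite := by
  refine finite_support_bind _ _ ?_ fun A => outerLoop_support_finite _ _ _ _ _ _ _ _ _ _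
  exact finite_support_bind _ _ (Set.toFinite _) fun π =>
    finite_support_map _ _ (Set.toFinite _)

end DASVRG

end

noncomputable section

namespace DASVRG

/-! ### Expectations under laws of finite support -/

/-! The proof first removes the data allocation, then analyses an inexact accelerated proximal
method whose subproblems are solved by SVRG with independent uniform samples.

Sampling. The indices `r_ℓ` are independent and uniform (`sampleIndex_law`): by symmetry, every
target sequence is produced by the same number of pairs (permutation, auxiliary indices), as counted
in `sum_perm_prod`. Drawing without replacement from the active machine amounts to reading such a
sequence in a randomly exchanged order, so each draw is fresh and uniform and leaves independent
uniform samples behind (`draw_law`). The sets `S_j` depend on the same permutation as the samples,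
but they enter only through the batch gradient, which is the full gradient for every permutation.
Hence `run_law`.

Inner loop. The gradient estimator is unbiased, and its variance is controlled by suboptimality at
the current and the reference point, with constant `L` instead of `L + σ` because the proximal terms
cancel (`variance_le`). A Lyapunov argument then contracts the expected error by `(8/9)^4` per stage
(`svrg_stage`). The number of stages is a logarithm to base `9/8`, so after `K` stages the factor is
at most the inverse fourth power of the argument of that logarithm; this slack covers all values of
`q` (`stage_contraction`).

Outer loop. With `a = √q`, all `α_p` equal `a` and `β_p` is constant. The potential `f(x) - f* +
(μ/2)‖v - x*‖²`, with `v = x + ((1+a)/a)(y - x)`, shrinks by the factor `1 - a` under an exact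
proximal step, up to a term `(4/a)·error` and a loss of `a/4` on the left (`outerLyapunov_step`).
The initial error of each subproblem is at most three times the potential (`prox_initial_error`), so
a fixed relative accuracy in each subproblem gives the factor `1 - a/2` in expectation
(`expect_outerLyapunov_le`). Both accuracy claims follow from this decay. -/

theorem expect_eq_sum {α : Type} (p : PMF α) (g : α → ℝ) (s : Finset α)
    (hs : p.support ⊆ s) : expect p g = ∑ a ∈ s, (p a).toReal * g a := by
  refine tsum_eq_sum fun a ha => ?_
  have : p a = 0 := by
    by_contra h
    exact ha (hs ((p.mem_support_iff a).2 h))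
  simp [this]

theorem expect_pure {α : Type} (a : α) (g : α → ℝ) : expect (PMF.pure a) g = g a := by
  rw [expect_eq_sum _ _ {a} (by simp)]
  simp

theorem expect_bind {α β : Type} (p : PMF α) (q : α → PMF β) (g : β → ℝ)
    (hp : p.support.Finite) (hq : ∀ a, (q a).support.Finite) :
    expect (p.bind q) g = expect p fun a => expect (q a) g := by
  classical
  set S := hp.toFinset with hS
  set S' := S.biUnion fun a => (hq a).toFinset with hS'
  have h1 : (p.bind q).support ⊆ S' := by
    intro b hb
    rw [PMF.mem_support_bind_iff] at hb
    obtain ⟨a, ha, hb⟩ := hb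
    simp only [hS', hS, Finset.coe_biUnion, Set.Finite.coe_toFinset, Set.mem_iUnion]
    exact ⟨a, ha, hb⟩
  have hS1 : p.support ⊆ S := by simp [hS]
  rw [expect_eq_sum _ _ S' h1, expect_eq_sum _ _ S hS1]
  have h2 : ∀ a ∈ S, expect (q a) g = ∑ b ∈ S', (q a b).toReal * g b := fun a ha =>
    expect_eq_sum _ _ _ (by
      intro b hb
      simp only [hS', Finset.coe_biUnion, Set.Finite.coe_toFinset, Set.mem_iUnion]
      exact ⟨a, ha, hb⟩)
  rw [Finset.sum_congr rfl fun a ha => congrArg (fun z => (p a).toReal * z) (h2 a ha)]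
  simp only [Finset.mul_sum]
  rw [Finset.sum_comm]
  refine Finset.sum_congr rfl fun b _ => ?_
  have h3 : ((p.bind q) b).toReal = ∑ a ∈ S, (p a).toReal * (q a b).toReal := by
    rw [PMF.bind_apply, tsum_eq_sum (s := S), ENNReal.toReal_sum]
    · simp
    · intro a _
      exact ENNReal.mul_ne_top (p.apply_ne_top a) ((q a).apply_ne_top b)
    · intro a ha
      have : p a = 0 := by
        by_contra h
        exact ha (hS1 ((p.mem_support_iff a).2 h))
      simp [this]
  rw [h3, Finset.sum_mul]
  exact Finset.sum_congr rfl fun a _ => by ring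

theorem expect_map {α β : Type} (p : PMF α) (q : α → β) (g : β → ℝ)
    (hp : p.support.Finite) : expect (p.map q) g = expect p fun a => g (q a) := by
  rw [← PMF.bind_pure_comp, expect_bind p (PMF.pure ∘ q) g hp fun a => finite_support_pure _]
  simp [expect_pure]

theorem expect_mono {α : Type} (p : PMF α) {g h : α → ℝ} (hp : p.support.Finite)
    (hgh : ∀ a, g a ≤ h a) : expect p g ≤ expect p h := by
  rw [expect_eq_sum p g hp.toFinset (by simp), expect_eq_sum p h hp.toFinset (by simp)]
  exact Finset.sum_le_sum fun a _ => mul_le_mul_of_nonneg_left (hgh a) ENNReal.toReal_nonneg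

theorem expect_const_mul {α : Type} (p : PMF α) (c : ℝ) (g : α → ℝ) :
    expect p (fun a => c * g a) = c * expect p g := by
  unfold expect
  rw [← tsum_mul_left]
  exact tsum_congr fun a => by ring

theorem expect_add_const {α : Type} (p : PMF α) (g : α → ℝ) (c : ℝ) (hp : p.support.Finite) :
    expect p (fun a => g a + c) = expect p g + c := by
  have h1 : ∑ a ∈ hp.toFinset, (p a).toReal = 1 := by
    have h := p.tsum_coe
    rw [tsum_eq_sum (s := hp.toFinset)] at h
    · rw [← ENNReal.toReal_sum fun a _ => p.apply_ne_top a, h, ENNReal.toReal_one]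
    · intro a ha
      by_contra h0
      exact ha (by simpa using h0)
  rw [expect_eq_sum p _ hp.toFinset (by simp), expect_eq_sum p g hp.toFinset (by simp)]
  simp only [mul_add, Finset.sum_add_distrib, ← Finset.sum_mul, h1, one_mul]

theorem expect_uniform {α : Type} [Fintype α] [Nonempty α] (g : α → ℝ) :
    expect (PMF.uniformOfFintype α) g = (1 / (Fintype.card α : ℝ)) * ∑ a, g a := by
  rw [expect_eq_sum _ _ Finset.univ (by simp), Finset.mul_sum]
  simp

/-! ### Uniform laws -/

theorem uniform_map_equiv {α β : Type} [Fintype α] [Nonempty α] [Fintype β] [Nonempty β]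
    (e : α ≃ β) : (PMF.uniformOfFintype α).map e = PMF.uniformOfFintype β := by
  ext b
  rw [PMF.map_apply, tsum_eq_single (e.symm b)]
  · simp [Fintype.card_congr e]
  · intro a ha
    have : b ≠ e a := fun h => ha (by simp [h])
    simp [this]

/-- Resampling one coordinate of a uniform family keeps it uniform. -/
theorem uniform_update {Q : ℕ} {α : Type} [Fintype α] [Nonempty α] [DecidableEq α] (s : Fin Q) :
    ((PMF.uniformOfFintype α).bind fun i =>
      (PMF.uniformOfFintype (Fin Q → α)).map fun r => Function.update r s i) =
    PMF.uniformOfFintype (Fin Q → α) := by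
  ext t
  have hα : (Fintype.card α : ENNReal) ≠ 0 := by simp
  -- The families that become `t` after the update exist only for `i = t s`, and are then `t` with
  -- an arbitrary value at `s`: `card α` of them.
  have h1 : ∀ i : α, ((PMF.uniformOfFintype (Fin Q → α)).map fun r => Function.update r s i) t =
      if i = t s then (Fintype.card α : ENNReal) * (Fintype.card (Fin Q → α) : ENNReal)⁻¹ else 0 := by
    intro i
    rw [PMF.map_apply, tsum_fintype]
    simp only [PMF.uniformOfFintype_apply]
    rw [← Finset.sum_filter, Finset.sum_const, nsmul_eq_mul]
    split_ifs with h
    · congr 2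
      rw [← Finset.card_univ]
      refine (Finset.card_bij (fun a _ => Function.update t s a) ?_ ?_ ?_).symm
      · intro a _
        simp [h]
      · intro a _ b _ hab
        simpa using congrFun hab s
      · intro r hr
        refine ⟨r s, Finset.mem_univ _, ?_⟩
        have := (Finset.mem_filter.1 hr).2
        rw [this]
        simp
    · have : (Finset.univ.filter fun r : Fin Q → α => t = Function.update r s i) = ∅ := by
        refine Finset.filter_eq_empty_iff.2 fun r _ hr => h ?_
        rw [hr]
        simp
      simp [this]
  rw [PMF.bind_apply, tsum_fintype]
  simp only [h1, PMF.uniformOfFintype_apply]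
  simp only [mul_ite, mul_zero, Finset.sum_ite_eq', Finset.mem_univ, if_true]
  rw [← mul_assoc, ENNReal.inv_mul_cancel hα (ENNReal.natCast_ne_top _), one_mul]

theorem ofMultiset_map {α β : Type} (B : Finset α) (hB : B.Nonempty) (r : α → β)
    (h : B.val.map r ≠ 0) :
    PMF.ofMultiset (B.val.map r) h = (PMF.uniformOfFinset B hB).map r := by
  classical
  ext b
  rw [PMF.ofMultiset_apply, PMF.map_apply, tsum_eq_sum (s := B)]
  · rw [Finset.sum_congr rfl fun a ha => by rw [PMF.uniformOfFinset_apply_of_mem _ ha]]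
    rw [← Finset.sum_filter, Finset.sum_const, nsmul_eq_mul, ENNReal.div_eq_inv_mul, mul_comm]
    rw [Multiset.card_map, Multiset.count_map]
    rfl
  · intro a ha
    simp [ha]

/-! ### The samples are independent and uniform -/

/-- For every family `t` of targets the pairs `(π, u)` that produce it are equally many. -/
theorem sum_perm_prod {N : ℕ} (Q : ℕ) (t : ℕ → Fin N) :
    ∑ π : Equiv.Perm (Fin N), ∏ l ∈ Finset.range Q,
      (Finset.univ.filter fun a : Fin N =>
        (if h : l ≤ (a : ℕ) then π ⟨l, lt_of_le_of_lt h a.isLt⟩ else π a) = t l).card =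
      Nat.factorial N := by
  induction Q with
  | zero => simp [Fintype.card_perm]
  | succ Q ih =>
    set w : Equiv.Perm (Fin N) → ℕ → ℕ := fun π l => (Finset.univ.filter fun a : Fin N =>
        (if h : l ≤ (a : ℕ) then π ⟨l, lt_of_le_of_lt h a.isLt⟩ else π a) = t l).card with hw
    change ∑ π, ∏ l ∈ Finset.range Q, w π l = _ at ih
    change ∑ π, ∏ l ∈ Finset.range (Q + 1), w π l = _
    simp only [Finset.prod_range_succ]
    rcases Nat.lt_or_ge Q N with hQ | hQ
    · set q : Fin N := ⟨Q, hQ⟩ with hq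
      set H : Finset (Fin N) := Finset.univ.filter fun a : Fin N => Q ≤ (a : ℕ) with hH
      -- The new factor splits according to whether the auxiliary index is at least `Q` (then it
      -- selects position `Q`) or below `Q` (then it selects an earlier entry).
      have hwQ : ∀ π, w π Q = (if π q = t Q then H.card else 0) +
          (Finset.univ.filter fun a : Fin N => (a : ℕ) < Q ∧ π a = t Q).card := by
        intro π
        have h1 : (Finset.univ.filter fun a : Fin N =>
            (if h : Q ≤ (a : ℕ) then π ⟨Q, lt_of_le_of_lt h a.isLt⟩ else π a) = t Q) =
            (if π q = t Q then H else ∅) ∪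
              (Finset.univ.filter fun a : Fin N => (a : ℕ) < Q ∧ π a = t Q) := by
          ext a
          by_cases h2 : Q ≤ (a : ℕ)
          · by_cases h3 : π q = t Q <;> simp_all
          · have h4 : (a : ℕ) < Q := not_le.1 h2
            by_cases h3 : π q = t Q <;> simp [h2, h3, h4, hH]
        change Finset.card _ = _
        rw [h1, Finset.card_union_of_disjoint]
        · split_ifs <;> simp
        · rw [Finset.disjoint_left]
          intro a ha hb
          split_ifs at ha
          · simp only [hH, Finset.mem_filter] at ha hb
            omega
          · simp at ha
      -- The earlier factors depend only on the values of `π` at positions below `Q`, so composing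
      -- `π` with the transposition of `Q` and any `b ≥ Q` changes nothing but the entry tested in
      -- the last factor. Averaging over all such `b` then makes the last factor 1.
      have hsw : ∀ b ∈ H, ∑ π, (∏ l ∈ Finset.range Q, w π l) * w π Q =
          ∑ π : Equiv.Perm (Fin N), (∏ l ∈ Finset.range Q, w π l) *
            ((if π b = t Q then H.card else 0) +
          (Finset.univ.filter fun a : Fin N => (a : ℕ) < Q ∧ π a = t Q).card) := by
        intro b hb
        have hb' : Q ≤ (b : ℕ) := by simpa [hH] using hb
        rw [← Equiv.sum_comp (Equiv.mulRight (Equiv.swap q b))]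
        refine Finset.sum_congr rfl fun π _ => ?_
        have hfix : ∀ a : Fin N, (a : ℕ) < Q → (π * Equiv.swap q b) a = π a := by
          intro a ha
          rw [Equiv.Perm.mul_apply, Equiv.swap_apply_of_ne_of_ne]
          · rintro rfl
            simp [hq] at ha
          · rintro rfl
            omega
        simp only [Equiv.coe_mulRight]
        congr 1
        · refine Finset.prod_congr rfl fun l hl => ?_
          have hl' := Finset.mem_range.1 hl
          change Finset.card _ = Finset.card _
          congr 1
          refine Finset.filter_congr fun a _ => ?_
          split_ifs with h
          · rw [hfix _ hl']
          · rw [hfix _ (by omega)]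
        · rw [hwQ]
          congr 1
          · simp
          · congr 1
            refine Finset.filter_congr fun a _ => ?_
            constructor
            · rintro ⟨h1, h2⟩
              exact ⟨h1, by rw [← h2, hfix a h1]⟩
            · rintro ⟨h1, h2⟩
              exact ⟨h1, by rw [← h2, hfix a h1]⟩
      have hHpos : 0 < H.card := Finset.card_pos.2 ⟨q, by simp [hH, hq]⟩
      have hsum : H.card * ∑ π, (∏ l ∈ Finset.range Q, w π l) * w π Q =
          H.card * Nat.factorial N := by
        rw [← smul_eq_mul, ← Finset.sum_const, Finset.sum_congr rfl hsw, Finset.sum_comm,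
          ← ih, Finset.mul_sum]
        refine Finset.sum_congr rfl fun π _ => ?_
        rw [← Finset.mul_sum, mul_comm]
        congr 1
        rw [Finset.sum_add_distrib, Finset.sum_const, smul_eq_mul, ← Finset.sum_filter,
          Finset.sum_const, smul_eq_mul, mul_comm, ← mul_add]
        -- Exactly one position carries the value `t Q`; it lies either in `H` or below `Q`.
        have h1 : (H.filter fun a => π a = t Q).card +
            (Finset.univ.filter fun a : Fin N => (a : ℕ) < Q ∧ π a = t Q).card = 1 := by
          rw [← Finset.card_union_of_disjoint]
          · rw [Finset.card_eq_one]
            refine ⟨π.symm (t Q), ?_⟩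
            ext a
            simp only [hH, Finset.mem_union, Finset.mem_filter, Finset.mem_univ, true_and,
              Finset.mem_singleton, ← or_and_right, Equiv.eq_symm_apply]
            constructor
            · exact fun h => h.2
            · exact fun h => ⟨le_or_gt _ _, h⟩
          · rw [Finset.disjoint_left]
            intro a ha hb
            simp only [hH, Finset.mem_filter] at ha hb
            omega
        rw [h1, mul_one]
      exact Nat.eq_of_mul_eq_mul_left hHpos hsum
    -- For `Q ≥ N` every auxiliary index is below `Q`, so the index is the value of `π` at a uniform
    -- position and the last factor is 1.
    · rw [← ih]
      refine Finset.sum_congr rfl fun π _ => ?_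
      have : w π Q = 1 := by
        change Finset.card _ = 1
        rw [Finset.card_eq_one]
        refine ⟨π.symm (t Q), ?_⟩
        ext a
        have : ¬ Q ≤ (a : ℕ) := by have := a.isLt; omega
        simp [this, Equiv.eq_symm_apply]
      rw [this, mul_one]

theorem card_sampleIndex {N Q : ℕ} [NeZero N] (t : Fin Q → Fin N) :
    ∑ π : Equiv.Perm (Fin N),
      (Finset.univ.filter fun u : Fin Q → Fin N => t = sampleIndex π u).card =
      Nat.factorial N := by
  rw [← sum_perm_prod Q fun l => if h : l < Q then t ⟨l, h⟩ else 0]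
  refine Finset.sum_congr rfl fun π _ => ?_
  rw [← Fin.prod_univ_eq_prod_range (fun l => (Finset.univ.filter fun a : Fin N =>
        (if h : l ≤ (a : ℕ) then π ⟨l, lt_of_le_of_lt h a.isLt⟩ else π a) =
          if h : l < Q then t ⟨l, h⟩ else 0).card) Q, ← Fintype.card_piFinset]
  congr 1
  ext u
  simp only [Finset.mem_filter, Finset.mem_univ, true_and, Fintype.mem_piFinset, Fin.is_lt,
    dif_pos, Fin.eta]
  rw [funext_iff]
  exact forall_congr' fun l => eq_comm

/-- The indices `r_l` produced by the data allocation are independent and uniform. -/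
theorem sampleIndex_law (N Q : ℕ) [NeZero N] :
    ((PMF.uniformOfFintype (Equiv.Perm (Fin N))).bind fun π =>
      (PMF.uniformOfFintype (Fin Q → Fin N)).map fun u => sampleIndex π u) =
    PMF.uniformOfFintype (Fin Q → Fin N) := by
  ext t
  rw [PMF.bind_apply, tsum_fintype]
  simp only [PMF.map_apply, tsum_fintype, PMF.uniformOfFintype_apply]
  simp only [← Finset.sum_filter, Finset.sum_const, nsmul_eq_mul]
  rw [← Finset.mul_sum, ← Finset.sum_mul, ← Nat.cast_sum, card_sampleIndex, Fintype.card_perm,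
    Fintype.card_fin, ← mul_assoc, ENNReal.inv_mul_cancel, one_mul]
  · simp [Nat.factorial_ne_zero]
  · exact ENNReal.natCast_ne_top _

/-! ### The law of the remaining samples -/

/-- The samples at positions `l ≥ s`, distributed over the machines. -/
def restSamples {N Q : ℕ} (nt : ℕ) (r : Fin Q → Fin N) (s j : ℕ) : Multiset (Fin N) :=
  (Finset.univ.filter fun l : Fin Q => s ≤ (l : ℕ) ∧ (l : ℕ) / nt = j).val.map r

/-- The machine that is active after `s` of the `Q` samples have been used. -/
def activeMachine (nt Q s : ℕ) : ℕ := if s < Q then s / nt else (Q + nt - 1) / nt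

/-- The law of the remaining samples and the active machine after `s` draws, when the samples are
independent and uniform. -/
def sampleLaw (N : ℕ) [NeZero N] (nt Q s : ℕ) : PMF ((ℕ → Multiset (Fin N)) × ℕ) :=
  (PMF.uniformOfFintype (Fin Q → Fin N)).map fun r =>
    (restSamples nt r s, activeMachine nt Q s)

/-- The switch occurs when no position after `s` remains in its block: either `s + 1` starts the
next block or `s` is the last sample. In the latter case the ceiling of `Q / nt` is the successor of
the last nonempty block. -/
theorem activeMachine_succ {nt Q s : ℕ} (hnt : 0 < nt) (hs : s < Q) :
    activeMachine nt Q (s + 1) =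
      if (Finset.univ.filter fun l : Fin Q => s + 1 ≤ (l : ℕ) ∧ (l : ℕ) / nt = s / nt) = ∅
      then s / nt + 1 else s / nt := by
  unfold activeMachine
  split_ifs with h1 h2 h2
  · have h3 := Finset.filter_eq_empty_iff.1 h2 (Finset.mem_univ ⟨s + 1, h1⟩)
    simp only [le_refl, true_and] at h3
    rw [Nat.succ_div] at h3 ⊢
    split_ifs at h3 ⊢ <;> simp_all
  · obtain ⟨l, hl⟩ := Finset.nonempty_iff_ne_empty.2 h2
    simp only [Finset.mem_filter, Finset.mem_univ, true_and] at hl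
    refine le_antisymm ?_ (Nat.div_le_div_right (Nat.le_succ s))
    rw [← hl.2]
    exact Nat.div_le_div_right hl.1
  · have : Q + nt - 1 = s + nt := by omega
    rw [this, Nat.add_div_right _ hnt]
  · obtain ⟨l, hl⟩ := Finset.nonempty_iff_ne_empty.2 h2
    simp only [Finset.mem_filter, Finset.mem_univ, true_and] at hl
    have := l.isLt
    omega

/-- One draw, for a fixed family of samples: drawing position `l` of the active block leaves the
same samples as exchanging positions `s` and `l` and then using up position `s`. -/
theorem draw_fixed {N Q nt s : ℕ} {β : Type} (hnt : 0 < nt) (hs : s < Q) (r : Fin Q → Fin N)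
    (G : Fin N → (ℕ → Multiset (Fin N)) → ℕ → β) (R : ℕ → Multiset (Fin N)) (k : ℕ)
    (hRdef : R = restSamples nt r s) (hk : k = s / nt) (hR : R k ≠ 0)
    (hB : (Finset.univ.filter fun l : Fin Q => s ≤ (l : ℕ) ∧ (l : ℕ) / nt = s / nt).Nonempty) :
    ((PMF.ofMultiset (R k) hR).map fun i =>
      G i (Function.update R k ((R k).erase i)) (if (R k).erase i = 0 then k + 1 else k)) =
    (PMF.uniformOfFinset _ hB).map fun l =>
      G (r l) (restSamples nt (r ∘ Equiv.swap ⟨s, hs⟩ l) (s + 1)) (activeMachine nt Q (s + 1)) := by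
  subst hRdef hk
  set B := Finset.univ.filter fun l : Fin Q => s ≤ (l : ℕ) ∧ (l : ℕ) / nt = s / nt with hBdef
  set B' := Finset.univ.filter fun l : Fin Q => s + 1 ≤ (l : ℕ) ∧ (l : ℕ) / nt = s / nt with hB'
  set s' : Fin Q := ⟨s, hs⟩ with hs'
  have hins : B = insert s' B' := by
    ext l
    simp only [hBdef, hB', hs', Finset.mem_insert, Finset.mem_filter, Finset.mem_univ, true_and,
      Fin.ext_iff]
    constructor
    · rintro ⟨h1, h2⟩
      rcases h1.eq_or_lt with h | h
      · exact Or.inl h.symm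
      · exact Or.inr ⟨h, h2⟩
    · rintro (h | ⟨h1, h2⟩)
      · simp [h]
      · exact ⟨by omega, h2⟩
  have hnot : s' ∉ B' := by simp [hB', hs']
  -- The transposition permutes the block `B`, so the multiset is unchanged by it, and the erased
  -- value `r l` now sits at position `s`, the one element of `B` outside `B'`.
  have key : ∀ l ∈ B, (restSamples nt r s (s / nt)).erase (r l) =
      B'.val.map (r ∘ Equiv.swap s' l) := by
    intro l hl
    have h1 : B.map (Equiv.swap s' l).toEmbedding = B := by
      refine Finset.map_perm fun a ha => ?_
      by_contra hab
      refine ha (Equiv.swap_apply_of_ne_of_ne ?_ ?_)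
      · rintro rfl
        exact hab (by rw [hins]; simp)
      · rintro rfl
        exact hab hl
    have h2 : restSamples nt r s (s / nt) = B.val.map (r ∘ Equiv.swap s' l) := by
      change B.val.map r = _
      conv_lhs => rw [← h1]
      rw [Finset.map_val, Multiset.map_map]
      rfl
    rw [h2, hins, Finset.insert_val_of_notMem hnot, Multiset.map_cons]
    simp
  change ((PMF.ofMultiset (B.val.map r) hR).map _) = _
  rw [ofMultiset_map B hB r hR, PMF.map_comp, ← PMF.bind_pure_comp, ← PMF.bind_pure_comp,
    -- Passing to the support makes `l ∈ B` available when the two continuations are compared.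
    ← PMF.bindOnSupport_eq_bind, ← PMF.bindOnSupport_eq_bind]
  congr 1
  funext l hl
  have hl : l ∈ B := by simpa using hl
  simp only [Function.comp_apply, key l hl]
  congr 2
  · funext j
    by_cases hj : j = s / nt
    · subst hj
      rw [Function.update_self]
      rfl
    · rw [Function.update_of_ne hj]
      unfold restSamples
      have h3 : (Finset.univ.filter fun l : Fin Q => s + 1 ≤ (l : ℕ) ∧ (l : ℕ) / nt = j) =
          Finset.univ.filter fun l : Fin Q => s ≤ (l : ℕ) ∧ (l : ℕ) / nt = j := by
        refine Finset.filter_congr fun a _ => ?_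
        constructor
        · rintro ⟨h1, h2⟩
          exact ⟨by omega, h2⟩
        · rintro ⟨h1, h2⟩
          refine ⟨lt_of_le_of_ne h1 ?_, h2⟩
          intro h
          rw [← h] at h2
          exact hj h2.symm
      rw [h3]
      refine Multiset.map_congr rfl fun a ha => ?_
      have ha' : (a : ℕ) / nt = j := by
        have := Finset.mem_filter.1 (Finset.mem_def.2 ha)
        exact this.2.2
      rw [Function.comp_apply, Equiv.swap_apply_of_ne_of_ne]
      · rintro rfl
        exact hj ha'.symm
      · rintro rfl
        simp only [hBdef, Finset.mem_filter] at hl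
        exact hj (ha'.symm.trans hl.2.2)
  · rw [activeMachine_succ hnt hs]
    have : (Multiset.map (r ∘ Equiv.swap s' l) B'.val = 0) ↔ B' = ∅ := by
      rw [Multiset.map_eq_zero, Finset.val_eq_zero]
    exact if_congr this rfl rfl

/-- A draw from the active machine is uniform and independent of the samples that remain. -/
theorem draw_law {N Q nt s : ℕ} [NeZero N] {β : Type} (hnt : 0 < nt) (hs : s < Q)
    (G : Fin N → (ℕ → Multiset (Fin N)) → ℕ → β)
    (D : (ℕ → Multiset (Fin N)) × ℕ → PMF β)
    (hD : ∀ (c : (ℕ → Multiset (Fin N)) × ℕ) (h : c.1 c.2 ≠ 0),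
      D c = (PMF.ofMultiset (c.1 c.2) h).map fun i =>
        G i (Function.update c.1 c.2 ((c.1 c.2).erase i))
          (if (c.1 c.2).erase i = 0 then c.2 + 1 else c.2)) :
    (sampleLaw N nt Q s).bind D =
      (PMF.uniformOfFintype (Fin N)).bind fun i =>
        (sampleLaw N nt Q (s + 1)).map fun c => G i c.1 c.2 := by
  set s' : Fin Q := ⟨s, hs⟩ with hs'
  have hB : (Finset.univ.filter fun l : Fin Q => s ≤ (l : ℕ) ∧ (l : ℕ) / nt = s / nt).Nonempty :=
    ⟨s', by simp [hs']⟩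
  have hact : activeMachine nt Q s = s / nt := if_pos hs
  have h1 : ∀ r : Fin Q → Fin N, D (restSamples nt r s, activeMachine nt Q s) =
      (PMF.uniformOfFinset _ hB).map fun l => G (r l)
        (restSamples nt (r ∘ Equiv.swap s' l) (s + 1)) (activeMachine nt Q (s + 1)) := by
    intro r
    have hne : restSamples nt r s (activeMachine nt Q s) ≠ 0 := by
      rw [hact]
      unfold restSamples
      rw [Ne, Multiset.map_eq_zero, Finset.val_eq_zero]
      exact hB.ne_empty
    rw [hD _ hne]
    exact draw_fixed hnt hs r G _ _ rfl hact hne hB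
  unfold sampleLaw
  rw [PMF.bind_map]
  have h2 : (D ∘ fun r : Fin Q → Fin N => (restSamples nt r s, activeMachine nt Q s)) =
      fun r => (PMF.uniformOfFinset _ hB).bind fun l => PMF.pure (G (r l)
        (restSamples nt (r ∘ Equiv.swap s' l) (s + 1)) (activeMachine nt Q (s + 1))) := by
    funext r
    rw [Function.comp_apply, h1]
    rfl
  rw [h2, PMF.bind_comm]
  set U := PMF.uniformOfFintype (Fin Q → Fin N) with hU
  set H : (Fin Q → Fin N) → β := fun r =>
    G (r s') (restSamples nt r (s + 1)) (activeMachine nt Q (s + 1)) with hH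
  -- Exchanging two coordinates preserves the uniform law, so the result does not depend on which
  -- `l` was drawn and one may take `l = s`.
  have h3 : ∀ l : Fin Q, (U.bind fun r => PMF.pure (G (r l)
      (restSamples nt (r ∘ Equiv.swap s' l) (s + 1)) (activeMachine nt Q (s + 1)))) = U.map H := by
    intro l
    have h4 : U.map (fun r => r ∘ Equiv.swap s' l) = U :=
      uniform_map_equiv ((Equiv.swap s' l).arrowCongr (Equiv.refl (Fin N)))
    conv_rhs => rw [← h4, PMF.map_comp]
    change _ = U.bind (PMF.pure ∘ _)
    congr 1
    funext r
    simp [hH]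
  simp only [h3, PMF.bind_const]
  -- Coordinate `s` is resampled as a fresh `i`; the remaining samples, at positions from `s + 1`
  -- on, do not see it. This yields the independence.
  conv_lhs => rw [hU, ← uniform_update s']
  rw [PMF.map_bind]
  congr 1
  funext i
  rw [PMF.map_comp, PMF.map_comp]
  congr 1
  funext r
  simp only [hH, Function.comp_apply, Function.update_self]
  congr 1
  funext j
  unfold restSamples
  refine Multiset.map_congr rfl fun a ha => Function.update_of_ne ?_ _ _
  rintro rfl
  have := (Finset.mem_filter.1 (Finset.mem_def.2 ha)).2.1
  simp [hs'] at this

/-! ### The method with independent uniform samples -/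

/-- A stage with independent uniform samples: the law of the iterate and the running average. -/
def iidInner {N d : ℕ} [NeZero N] (g : Fin N → Vec d → ℝ) (η : ℝ) (xt h : Vec d) :
    ℕ → PMF (Vec d × Vec d)
  | 0 => PMF.pure (xt, 0)
  | t + 1 => (iidInner g η xt h t).bind fun z =>
      (PMF.uniformOfFintype (Fin N)).map fun i =>
        (z.1 - η • (gradient (g i) z.1 - gradient (g i) xt + h),
          (1 / ((t : ℝ) + 1)) •
            (z.1 - η • (gradient (g i) z.1 - gradient (g i) xt + h) + (t : ℝ) • z.2))

/-- The stages of an outer iteration with independent uniform samples. -/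
def iidStage {N d : ℕ} [NeZero N] (h : Vec d → Vec d) (g : Fin N → Vec d → ℝ) (η : ℝ) (T : ℕ)
    (x : Vec d) : ℕ → PMF (Vec d)
  | 0 => PMF.pure x
  | l + 1 => (iidStage h g η T x l).bind fun x' => (iidInner g η x' (h x') T).map Prod.snd

/-- The outer iterations with independent uniform samples; the state is `(x̂_p, y_p, y_{p-1})`. -/
def iidOuter {N d : ℕ} [NeZero N] (h : (Fin N → Vec d → ℝ) → Vec d → Vec d)
    (f : Fin N → Vec d → ℝ) (μ σ η : ℝ) (T K : ℕ) (x0 : Vec d) : ℕ → PMF (Vec d × Vec d × Vec d)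
  | 0 => PMF.pure (x0, x0, x0)
  | p + 1 => (iidOuter h f μ σ η T K x0 p).bind fun s =>
      (iidStage (h (proxComponent f σ s.2.1)) (proxComponent f σ s.2.1) η T s.1 K).map fun x =>
        (x, x + betaNext (ratio μ σ) p • (x - s.1), s.2.1)

/-- The invariant is a product law: iterates and sampling state stay independent, the latter having
consumed `t` more samples. Each update is an instance of `draw_law`; the next two lemmas carry the
same invariant through stages and outer iterations. -/
theorem innerLoop_law {N d nt Q s t : ℕ} [NeZero N] (hnt : 0 < nt) (g : Fin N → Vec d → ℝ) (η : ℝ)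
    (xt h : Vec d) (hst : s + t ≤ Q) :
    ((sampleLaw N nt Q s).bind fun c => innerLoop g η xt h c.1 c.2 t) =
      (iidInner g η xt h t).bind fun z => (sampleLaw N nt Q (s + t)).map fun c =>
        (⟨z.1, z.2, c.1, c.2⟩ : InnerState N d) := by
  induction t with
  | zero =>
    simp only [innerLoop, iidInner, PMF.pure_bind, add_zero]
    rfl
  | succ t ih =>
    simp only [innerLoop, iidInner]
    rw [← PMF.bind_bind, ih (by omega), PMF.bind_bind, PMF.bind_bind]
    congr 1
    funext z
    rw [PMF.bind_map, PMF.bind_map]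
    refine draw_law hnt (by omega) (fun i R k =>
      (⟨z.1 - η • (gradient (g i) z.1 - gradient (g i) xt + h), (1 / ((t : ℝ) + 1)) •
            (z.1 - η • (gradient (g i) z.1 - gradient (g i) xt + h) + (t : ℝ) • z.2), R, k⟩ :
        InnerState N d)) _ ?_
    intro c hc
    simp only [Function.comp_apply, innerStep, dif_neg hc]

theorem stageLoop_law {N d nt Q s m T l : ℕ} [NeZero N] (hnt : 0 < nt) (S : ℕ → Finset (Fin N))
    (g : Fin N → Vec d → ℝ) (η : ℝ) (x : Vec d) (hst : s + T * l ≤ Q) :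
    ((sampleLaw N nt Q s).bind fun c => stageLoop m S g η T ⟨x, c.1, c.2⟩ l) =
      (iidStage (batchGradient m S g) g η T x l).bind fun x' =>
        (sampleLaw N nt Q (s + T * l)).map fun c => (⟨x', c.1, c.2⟩ : StageState N d) := by
  induction l with
  | zero =>
    simp only [stageLoop, iidStage, PMF.pure_bind, mul_zero, add_zero]
    rfl
  | succ l ih =>
    simp only [stageLoop, iidStage]
    rw [mul_add, mul_one, ← add_assoc] at hst ⊢
    rw [← PMF.bind_bind, ih (by omega), PMF.bind_bind, PMF.bind_bind]
    congr 1
    funext z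
    rw [PMF.bind_map, PMF.bind_map]
    have h1 := innerLoop_law (s := s + T * l) (t := T) hnt g η z (batchGradient m S g z) hst
    have h2 := congrArg (PMF.map fun r : InnerState N d => (⟨r.xbar, r.R, r.k⟩ : StageState N d)) h1
    rw [PMF.map_bind, PMF.map_bind] at h2
    simp only [PMF.map_comp] at h2
    exact h2

theorem outerLoop_law {N d nt Q m T K p : ℕ} [NeZero N] (hnt : 0 < nt) (S : ℕ → Finset (Fin N))
    (f : Fin N → Vec d → ℝ) (μ σ η : ℝ) (x0 : Vec d) (hst : T * K * p ≤ Q) :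
    ((sampleLaw N nt Q 0).bind fun c => outerLoop f μ σ η m T K x0 ⟨S, c.1⟩ p) =
      (iidOuter (batchGradient m S) f μ σ η T K x0 p).bind fun z =>
        (sampleLaw N nt Q (T * K * p)).map fun c =>
          (⟨z.1, z.2.1, z.2.2, c.1, c.2⟩ : OuterState N d) := by
  induction p with
  | zero =>
    simp only [outerLoop, iidOuter, PMF.pure_bind, mul_zero]
    unfold sampleLaw
    rw [PMF.bind_map, PMF.map_comp, ← PMF.bind_pure_comp]
    congr 1
    funext r
    simp only [Function.comp_apply]
    congr 2
    unfold activeMachine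
    split_ifs with h
    · simp
    · have : Q = 0 := by omega
      subst this
      rw [Nat.div_eq_of_lt (by omega)]
  | succ p ih =>
    simp only [outerLoop, iidOuter]
    rw [mul_add, mul_one] at hst ⊢
    rw [← PMF.bind_bind, ih (by omega), PMF.bind_bind, PMF.bind_bind]
    congr 1
    funext z
    rw [PMF.bind_map, PMF.bind_map]
    have h1 := stageLoop_law (m := m) (s := T * K * p) (l := K) hnt S (proxComponent f σ z.2.1) η
      z.1 hst
    have h2 := congrArg (PMF.map fun r : StageState N d => (⟨r.x,
      r.x + betaNext (ratio μ σ) p • (r.x - z.1), z.2.1, r.R, r.k⟩ : OuterState N d)) h1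
    rw [PMF.map_bind, PMF.map_bind] at h2
    simp only [PMF.map_comp] at h2
    exact h2

/-! ### The batch gradient -/

/-- The `m` blocks of positions partition the positions, so every function is counted once whatever
the permutation. -/
theorem batchGradient_partSet {N m n d : ℕ} (hN : N = m * n) (π : Equiv.Perm (Fin N))
    (g : Fin N → Vec d → ℝ) (x : Vec d) :
    batchGradient m (partSet n π) g x = (1 / (N : ℝ)) • ∑ i, gradient (g i) x := by
  unfold batchGradient partSet
  congr 1
  simp only [Finset.sum_map, Equiv.coe_toEmbedding]
  rw [Finset.sum_fiberwise_of_maps_to (fun l _ => ?_) fun l => gradient (g (π l)) x]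
  · exact Equiv.sum_comp π fun i => gradient (g i) x
  · rw [Finset.mem_range]
    refine Nat.div_lt_of_lt_mul ?_
    have := l.isLt
    rw [mul_comm]
    omega

theorem iidOuter_congr {N d : ℕ} [NeZero N] {h h' : (Fin N → Vec d → ℝ) → Vec d → Vec d}
    (hh : ∀ g x, h g x = h' g x) : @iidOuter N d _ h = @iidOuter N d _ h' := by
  have : h = h' := funext fun g => funext fun x => hh g x
  rw [this]

theorem stageLoop_congr {N d m T l : ℕ} {S S' : ℕ → Finset (Fin N)} {g : Fin N → Vec d → ℝ} {η : ℝ}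
    (hS : ∀ x, batchGradient m S g x = batchGradient m S' g x) (s : StageState N d) :
    stageLoop m S g η T s l = stageLoop m S' g η T s l := by
  induction l with
  | zero => rfl
  | succ l ih => simp only [stageLoop, ih, hS]

/-- The partition enters the method only through batch gradients. This allows it to be replaced by a
fixed one although it is correlated with the samples. -/
theorem outerLoop_congr {N d m T K p : ℕ} {S S' : ℕ → Finset (Fin N)} {f : Fin N → Vec d → ℝ}
    {μ σ η : ℝ} {x0 : Vec d}
    (hS : ∀ (g : Fin N → Vec d → ℝ) (x), batchGradient m S g x = batchGradient m S' g x)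
    (R : ℕ → Multiset (Fin N)) :
    outerLoop f μ σ η m T K x0 ⟨S, R⟩ p = outerLoop f μ σ η m T K x0 ⟨S', R⟩ p := by
  induction p with
  | zero => rfl
  | succ p ih =>
    simp only [outerLoop, ih]
    congr 1
    funext s
    rw [stageLoop_congr (hS _)]

/-- The gradient of the average of the components. -/
def fullGradient {N d : ℕ} (g : Fin N → Vec d → ℝ) (x : Vec d) : Vec d :=
  (1 / (N : ℝ)) • ∑ i, gradient (g i) x

/-- The iterates of the method are distributed as if the samples were independent and uniform. -/
theorem run_law {N d nt Q m n T K p : ℕ} [NeZero N] (hN : N = m * n) (hnt : 0 < nt)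
    (f : Fin N → Vec d → ℝ) (μ σ η : ℝ) (x0 : Vec d) (hQ : T * K * p ≤ Q) :
    run f μ σ η m n nt T K Q x0 p =
      (iidOuter fullGradient f μ σ η T K x0 p).bind fun z =>
        (sampleLaw N nt Q (T * K * p)).map fun c =>
          (⟨z.1, z.2.1, z.2.2, c.1, c.2⟩ : OuterState N d) := by
  -- The partition of the identity permutation serves as the fixed reference partition.
  rw [iidOuter_congr (h := fullGradient) (h' := batchGradient m (partSet n 1))
    fun g x => (batchGradient_partSet hN 1 g x).symm, ← outerLoop_law hnt _ f μ σ η x0 hQ]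
  have h1 : ∀ r : Fin Q → Fin N, sampleSet nt r = restSamples nt r 0 := by
    intro r
    funext j
    simp [sampleSet, restSamples]
  unfold run dataAllocation sampleLaw
  rw [PMF.bind_map]
  conv_rhs => rw [← sampleIndex_law, PMF.bind_bind]
  rw [PMF.bind_bind]
  congr 1
  funext π
  rw [PMF.bind_map, PMF.bind_map]
  congr 1
  funext u
  simp only [Function.comp_apply, h1]
  exact outerLoop_congr (fun g x => by
    rw [batchGradient_partSet hN, batchGradient_partSet hN]) _

theorem iidInner_support_finite {N d : ℕ} [NeZero N] (g : Fin N → Vec d → ℝ) (η : ℝ)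
    (xt h : Vec d) (t : ℕ) : (iidInner g η xt h t).support.Finite := by
  induction t with
  | zero => exact finite_support_pure _
  | succ t ih =>
    exact finite_support_bind _ _ ih fun s => finite_support_map _ _ (Set.toFinite _)

theorem iidStage_support_finite {N d : ℕ} [NeZero N] (h : Vec d → Vec d) (g : Fin N → Vec d → ℝ)
    (η : ℝ) (T : ℕ) (x : Vec d) (l : ℕ) : (iidStage h g η T x l).support.Finite := by
  induction l with
  | zero => exact finite_support_pure _
  | succ l ih =>
    exact finite_support_bind _ _ ih fun s =>
      finite_support_map _ _ (iidInner_support_finite _ _ _ _ _)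

theorem iidOuter_support_finite {N d : ℕ} [NeZero N] (h : (Fin N → Vec d → ℝ) → Vec d → Vec d)
    (f : Fin N → Vec d → ℝ) (μ σ η : ℝ) (T K : ℕ) (x0 : Vec d) (p : ℕ) :
    (iidOuter h f μ σ η T K x0 p).support.Finite := by
  induction p with
  | zero => exact finite_support_pure _
  | succ p ih =>
    exact finite_support_bind _ _ ih fun s =>
      finite_support_map _ _ (iidStage_support_finite _ _ _ _ _ _)

/-- Expectations of functions of the iterates under the law of the run. -/
theorem expect_run {N d nt Q m n T K p : ℕ} [NeZero N] (hN : N = m * n) (hnt : 0 < nt)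
    (f : Fin N → Vec d → ℝ) (μ σ η : ℝ) (x0 : Vec d) (hQ : T * K * p ≤ Q)
    (G : OuterState N d → ℝ) (G' : Vec d × Vec d × Vec d → ℝ)
    (hG : ∀ s, G s = G' (s.xhat, s.y, s.yPrev)) :
    expect (run f μ σ η m n nt T K Q x0 p) G =
      expect (iidOuter fullGradient f μ σ η T K x0 p) G' := by
  have hfin : (sampleLaw N nt Q (T * K * p)).support.Finite :=
    finite_support_map _ _ (Set.toFinite _)
  rw [run_law hN hnt f μ σ η x0 hQ, expect_bind _ _ _ (iidOuter_support_finite _ _ _ _ _ _ _ _ _)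
    fun z => finite_support_map _ _ hfin]
  congr 1
  funext z
  rw [expect_map _ _ _ hfin]
  have h0 := expect_add_const (sampleLaw N nt Q (T * K * p)) (fun _ => 0) (G' z) hfin
  have h1 : expect (sampleLaw N nt Q (T * K * p)) (fun _ => 0) = 0 := by simp [expect]
  simp only [hG, zero_add, h1] at h0 ⊢
  exact h0

/-! ### Smooth convex functions -/

section Convex

variable {E : Type*} [NormedAddCommGroup E] [InnerProductSpace ℝ E] [CompleteSpace E]
  {f : E → ℝ} {G : E → E}

theorem hasDerivAt_comp_lineMap (hG : ∀ x, HasGradientAt f (G x) x) (x y : E) (t : ℝ) :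
    HasDerivAt (fun t => f (AffineMap.lineMap x y t))
      (inner ℝ (G (AffineMap.lineMap x y t)) (y - x)) t := by
  have h1 := (hG (AffineMap.lineMap x y t)).hasFDerivAt.comp_hasDerivAt t
    (AffineMap.hasDerivAt_lineMap (a := x) (b := y) (x := t))
  exact h1.congr_deriv (by simp)

theorem add_inner_le_of_convexOn (hG : ∀ x, HasGradientAt f (G x) x)
    (hf : ConvexOn ℝ Set.univ f) (x y : E) : f x + inner ℝ (G x) (y - x) ≤ f y := by
  have h1 : ConvexOn ℝ Set.univ (fun t : ℝ => f (AffineMap.lineMap x y t)) := by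
    have h := hf.comp_affineMap (AffineMap.lineMap x y)
    rwa [Set.preimage_univ] at h
  have h2 := h1.le_slope_of_hasDerivAt (Set.mem_univ 0) (Set.mem_univ 1) one_pos
    (hasDerivAt_comp_lineMap hG x y 0)
  simp [slope_def_field] at h2
  linarith

theorem le_add_inner_of_lipschitz {L : ℝ} (hG : ∀ x, HasGradientAt f (G x) x)
    (hL : ∀ x y, ‖G x - G y‖ ≤ L * ‖x - y‖) (x y : E) :
    f y ≤ f x + inner ℝ (G x) (y - x) + L / 2 * ‖y - x‖ ^ 2 := by
  -- The function minus its claimed upper bound along the segment; the Lipschitz condition and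
  -- Cauchy-Schwarz make it decreasing.
  set φ : ℝ → ℝ := fun t => f (AffineMap.lineMap x y t) - t * inner ℝ (G x) (y - x) -
    L / 2 * t ^ 2 * ‖y - x‖ ^ 2 with hφ
  have hd : ∀ t, HasDerivAt φ (inner ℝ (G (AffineMap.lineMap x y t)) (y - x) -
      inner ℝ (G x) (y - x) - L * t * ‖y - x‖ ^ 2) t := by
    intro t
    have h1 := ((hasDerivAt_comp_lineMap hG x y t).sub
      ((hasDerivAt_id t).mul_const (inner ℝ (G x) (y - x)))).sub
      ((((hasDerivAt_id t).pow 2).const_mul (L / 2)).mul_const (‖y - x‖ ^ 2))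
    refine h1.congr_deriv ?_
    simp only [id]
    ring
  have hanti : AntitoneOn φ (Set.Icc 0 1) := by
    refine antitoneOn_of_deriv_nonpos (convex_Icc 0 1)
      (fun t _ => (hd t).continuousAt.continuousWithinAt)
      (fun t _ => (hd t).differentiableAt.differentiableWithinAt) fun t ht => ?_
    rw [interior_Icc] at ht
    rw [(hd t).deriv, ← inner_sub_left]
    have h1 := real_inner_le_norm (G (AffineMap.lineMap x y t) - G x) (y - x)
    have h2 := hL (AffineMap.lineMap x y t) x
    have h3 : AffineMap.lineMap x y t - x = t • (y - x) := by
      rw [AffineMap.lineMap_apply]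
      simp
    rw [h3, norm_smul, Real.norm_of_nonneg ht.1.le] at h2
    nlinarith [mul_le_mul_of_nonneg_right h2 (norm_nonneg (y - x))]
  have h := hanti (Set.left_mem_Icc.2 zero_le_one) (Set.right_mem_Icc.2 zero_le_one) zero_le_one
  simp [hφ] at h
  linarith

theorem hasGradientAt_sub_inner (hG : ∀ x, HasGradientAt f (G x) x) (p x : E) :
    HasGradientAt (fun z => f z - inner ℝ p z) (G x - p) x := by
  rw [hasGradientAt_iff_hasFDerivAt, map_sub]
  exact (hG x).hasFDerivAt.sub ((InnerProductSpace.toDual ℝ E) p).hasFDerivAt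

/-- A gradient step decreases a smooth function. -/
theorem gradient_step_le {L : ℝ} (hG : ∀ x, HasGradientAt f (G x) x)
    (hL : ∀ x y, ‖G x - G y‖ ≤ L * ‖x - y‖) (h : ℝ) (x : E) :
    f (x - h • G x) ≤ f x - h * (1 - L * h / 2) * ‖G x‖ ^ 2 := by
  have h1 := le_add_inner_of_lipschitz hG hL x (x - h • G x)
  have h2 : x - h • G x - x = -(h • G x) := by abel
  rw [h2, norm_neg, norm_smul, inner_neg_right, inner_smul_right,
    real_inner_self_eq_norm_sq, mul_pow, Real.norm_eq_abs, sq_abs] at h1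
  linarith

/-- After subtracting the linear part at `y`, the function is minimal at `y`, and a gradient step of
length `1/L` from `x` cannot go below that minimum. -/
theorem norm_sub_sq_le_of_convexOn {L : ℝ} (hL0 : 0 < L) (hG : ∀ x, HasGradientAt f (G x) x)
    (hf : ConvexOn ℝ Set.univ f) (hL : ∀ x y, ‖G x - G y‖ ≤ L * ‖x - y‖) (x y : E) :
    ‖G x - G y‖ ^ 2 ≤ 2 * L * (f x - f y - inner ℝ (G y) (x - y)) := by
  have h1 := gradient_step_le (hasGradientAt_sub_inner hG (G y))
    (L := L) (fun a b => by simpa using hL a b) (1 / L) x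
  have h2 := add_inner_le_of_convexOn hG hf y (x - (1 / L) • (G x - G y))
  rw [inner_sub_right] at h1 h2 ⊢
  rw [inner_sub_right] at h2
  have h3 : 1 / L * (1 - L * (1 / L) / 2) = 1 / (2 * L) := by field_simp; norm_num
  rw [h3] at h1
  have h4 : 1 / (2 * L) * ‖G x - G y‖ ^ 2 ≤ f x - f y - (inner ℝ (G y) x - inner ℝ (G y) y) := by
    linarith
  rw [div_mul_eq_mul_div, one_mul, div_le_iff₀ (by positivity)] at h4
  linarith

/-- A convex smooth function with `μ`-expanding gradient grows quadratically around a minimizer: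
follow the gradient descent with step `h` to the minimizer. -/
theorem quadratic_growth_aux {L μ h : ℝ} (hμ : 0 < μ) (hh : 0 < h) (hh2 : L * h < 2)
    (hG : ∀ x, HasGradientAt f (G x) x) (hL : ∀ x y, ‖G x - G y‖ ≤ L * ‖x - y‖)
    {y : E} (hexp : ∀ x, μ * ‖x - y‖ ≤ ‖G x‖) (hmin : ∀ x, f y ≤ f x) (x : E) :
    (1 - L * h / 2) * (μ / 2 * ‖x - y‖ ^ 2) ≤ f x - f y := by
  set c := 1 - L * h / 2 with hc
  have hc0 : 0 < c := by linarith
  set z : ℕ → E := fun k => (fun w => w - h • G w)^[k] x with hz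
  have hzs : ∀ k, z (k + 1) = z k - h • G (z k) := fun k => by
    simp only [hz, Function.iterate_succ_apply']
  have hdec : ∀ k, f (z (k + 1)) ≤ f (z k) - h * c * ‖G (z k)‖ ^ 2 := fun k => by
    rw [hzs]
    exact gradient_step_le hG hL h (z k)
  -- Along the descent the quadratic loses at most what `f` loses: the step moves by `h‖G‖`, and the
  -- expanding gradient bounds the distance to `y` by `‖G‖/μ`.
  have hstep : ∀ k, c * (μ / 2 * ‖z k - y‖ ^ 2) - f (z k) ≤
      c * (μ / 2 * ‖z (k + 1) - y‖ ^ 2) - f (z (k + 1)) := by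
    intro k
    have h1 := hdec k
    have h2 := hexp (z k)
    have h3 : ‖z k - y‖ ≤ ‖z (k + 1) - y‖ + h * ‖G (z k)‖ := by
      have : z k - y = (z (k + 1) - y) + h • G (z k) := by rw [hzs]; abel
      calc ‖z k - y‖ = ‖(z (k + 1) - y) + h • G (z k)‖ := by rw [← this]
        _ ≤ _ := by
          refine (norm_add_le _ _).trans ?_
          rw [norm_smul, Real.norm_of_nonneg hh.le]
    set A := ‖z k - y‖
    set B := ‖z (k + 1) - y‖
    set g := ‖G (z k)‖
    have hA : 0 ≤ A := norm_nonneg _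
    have hg : 0 ≤ g := norm_nonneg _
    have h4 : μ * (A ^ 2 - B ^ 2) / 2 ≤ h * g ^ 2 := by
      have h5 : (A ^ 2 - B ^ 2) / 2 ≤ A * (h * g) := by nlinarith [sq_nonneg (A - B)]
      have h6 : μ * A * (h * g) ≤ g * (h * g) :=
        mul_le_mul_of_nonneg_right h2 (by positivity)
      nlinarith
    nlinarith [mul_le_mul_of_nonneg_left h4 hc0.le]
  have hmono : Monotone fun k => c * (μ / 2 * ‖z k - y‖ ^ 2) - f (z k) :=
    monotone_nat_of_le_succ hstep
  set δ := h * c * μ ^ 2 with hδ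
  have hδ0 : 0 < δ := by positivity
  -- The total decrease of `f` is finite, so the squared distances are summable and the descent
  -- converges to `y`.
  have hsum : ∀ n, ∑ k ∈ Finset.range n, δ * ‖z k - y‖ ^ 2 ≤ f x - f y := by
    have h1 : ∀ n, ∑ k ∈ Finset.range n, δ * ‖z k - y‖ ^ 2 ≤ f x - f (z n) := by
      intro n
      induction n with
      | zero => simp [hz]
      | succ n ih =>
        rw [Finset.sum_range_succ]
        have h2 := hdec n
        have h3 : (μ * ‖z n - y‖) ^ 2 ≤ ‖G (z n)‖ ^ 2 :=
          pow_le_pow_left₀ (by positivity) (hexp _) 2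
        have h4 := mul_le_mul_of_nonneg_left h3 (mul_pos hh hc0).le
        have h5 : δ * ‖z n - y‖ ^ 2 = h * c * (μ * ‖z n - y‖) ^ 2 := by rw [hδ]; ring
        linarith
    intro n
    linarith [h1 n, hmin (z n)]
  have htend : Filter.Tendsto (fun k => δ * ‖z k - y‖ ^ 2) Filter.atTop (nhds 0) :=
    (summable_of_sum_range_le (fun k => by positivity) hsum).tendsto_atTop_zero
  have htend2 : Filter.Tendsto (fun k => c * (μ / 2 * ‖z k - y‖ ^ 2) - f y) Filter.atTop
      (nhds (0 - f y)) := by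
    refine Filter.Tendsto.sub_const ?_ _
    have h1 := htend.const_mul (c * (μ / 2) / δ)
    rw [mul_zero] at h1
    refine h1.congr fun k => ?_
    field_simp
  have h1 : c * (μ / 2 * ‖x - y‖ ^ 2) - f x ≤ 0 - f y := by
    refine ge_of_tendsto' htend2 fun k => ?_
    have h2 := hmono (Nat.zero_le k)
    have h3 : z 0 = x := rfl
    simp only [h3] at h2
    linarith [hmin (z k)]
  linarith

/-- A convex smooth function with `μ`-expanding gradient is `μ`-strongly convex. -/
theorem strong_convex_of_expanding {L μ : ℝ} (hL0 : 0 < L) (hμ : 0 < μ)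
    (hG : ∀ x, HasGradientAt f (G x) x) (hf : ConvexOn ℝ Set.univ f)
    (hL : ∀ x y, ‖G x - G y‖ ≤ L * ‖x - y‖) (hexp : ∀ x y, μ * ‖x - y‖ ≤ ‖G x - G y‖) (x y : E) :
    f y + inner ℝ (G y) (x - y) + μ / 2 * ‖x - y‖ ^ 2 ≤ f x := by
  have hmin : ∀ z, f y - inner ℝ (G y) y ≤ f z - inner ℝ (G y) z := by
    intro z
    have h1 := add_inner_le_of_convexOn hG hf y z
    rw [inner_sub_right] at h1
    linarith
  have h1 : ∀ h : ℝ, 0 < h → L * h < 2 → (1 - L * h / 2) * (μ / 2 * ‖x - y‖ ^ 2) ≤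
      (f x - inner ℝ (G y) x) - (f y - inner ℝ (G y) y) := fun h hh hh2 =>
    quadratic_growth_aux (f := fun z => f z - inner ℝ (G y) z) hμ hh hh2
      (hasGradientAt_sub_inner hG (G y)) (L := L) (fun a b => by simpa using hL a b)
      (fun z => hexp z y) hmin x
  -- Letting the step length tend to zero removes the loss factor and gives the sharp constant `μ`.
  have h2 : Filter.Tendsto (fun h : ℝ => (1 - L * h / 2) * (μ / 2 * ‖x - y‖ ^ 2))
      (nhdsWithin 0 (Set.Ioi 0)) (nhds ((1 - L * 0 / 2) * (μ / 2 * ‖x - y‖ ^ 2))) := by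
    refine tendsto_nhdsWithin_of_tendsto_nhds (Continuous.tendsto ?_ 0)
    fun_prop
  have h3 := le_of_tendsto h2 (b := (f x - inner ℝ (G y) x) - (f y - inner ℝ (G y) y)) (by
    filter_upwards [Ioo_mem_nhdsGT (show (0 : ℝ) < 2 / L by positivity)] with h hh
    refine h1 h hh.1 ?_
    have := hh.2
    rw [lt_div_iff₀ hL0] at this
    linarith)
  rw [inner_sub_right]
  linarith

end Convex

/-- A convex combination in a function with a quadratic lower bound at every point. -/
theorem strong_convex_combination {E : Type*} [NormedAddCommGroup E]
    [InnerProductSpace ℝ E] {f : E → ℝ} {G : E → E} {μ : ℝ}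
    (h : ∀ x y, f y + inner ℝ (G y) (x - y) + μ / 2 * ‖x - y‖ ^ 2 ≤ f x)
    {a b : ℝ} (ha : 0 ≤ a) (hb : 0 ≤ b) (hab : a + b = 1) (x y : E) :
    f (a • x + b • y) ≤ a * f x + b * f y - μ / 2 * (a * b) * ‖x - y‖ ^ 2 := by
  obtain rfl : a = 1 - b := by linarith
  set z := (1 - b) • x + b • y with hz
  have h1 := h x z
  have h2 := h y z
  have h3 : x - z = b • (x - y) := by rw [hz]; module
  have h4 : y - z = -((1 - b) • (x - y)) := by rw [hz]; module
  rw [h3, inner_smul_right, norm_smul, mul_pow, Real.norm_eq_abs, sq_abs] at h1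
  rw [h4, inner_neg_right, inner_smul_right, norm_neg, norm_smul, mul_pow, Real.norm_eq_abs,
    sq_abs] at h2
  nlinarith [mul_le_mul_of_nonneg_left h1 ha, mul_le_mul_of_nonneg_left h2 hb]

/-- The standing assumptions on the family of functions. -/
structure IsRegular {N d : ℕ} (f : Fin N → Vec d → ℝ) (L μ : ℝ) : Prop where
  L_pos : 0 < L
  mu_pos : 0 < μ
  convex : ∀ i, ConvexOn ℝ Set.univ (f i)
  smooth : ∀ i, IsSmooth L (f i)
  expanding : GradExpanding μ (objective f)

namespace IsRegular

variable {N d : ℕ} {f : Fin N → Vec d → ℝ} {L μ σ : ℝ}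

theorem hasGradientAt (hf : IsRegular f L μ) (i : Fin N) (x : Vec d) :
    HasGradientAt (f i) (gradient (f i) x) x :=
  ((hf.smooth i).1 x).hasGradientAt

theorem hasGradientAt_objective (hf : IsRegular f L μ) (x : Vec d) :
    HasGradientAt (objective f) (fullGradient f x) x := by
  rw [hasGradientAt_iff_hasFDerivAt]
  have h1 := (HasFDerivAt.fun_sum (u := Finset.univ) fun i _ =>
    (hf.hasGradientAt i x).hasFDerivAt).const_mul (1 / (N : ℝ))
  refine h1.congr_fderiv ?_
  simp [fullGradient]

theorem fullGradient_lipschitz [NeZero N] (hf : IsRegular f L μ) (x y : Vec d) :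
    ‖fullGradient f x - fullGradient f y‖ ≤ L * ‖x - y‖ := by
  have hN : (0 : ℝ) < N := Nat.cast_pos.2 (NeZero.pos N)
  unfold fullGradient
  rw [← smul_sub, ← Finset.sum_sub_distrib, norm_smul, Real.norm_of_nonneg (by positivity),
    div_mul_eq_mul_div, one_mul, div_le_iff₀ hN]
  refine (norm_sum_le_of_le _ fun i _ => (hf.smooth i).2 x y).trans ?_
  simp [mul_comm]

/-- Only in dimension zero can `μ` exceed `L`; there every error vanishes, and the lower bound on
the stage length is not needed. -/
theorem mu_le_of_ne [NeZero N] (hf : IsRegular f L μ) {x y : Vec d} (hxy : x ≠ y) : μ ≤ L := by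
  have h1 := hf.expanding x y
  rw [(hf.hasGradientAt_objective x).gradient, (hf.hasGradientAt_objective y).gradient] at h1
  exact le_of_mul_le_mul_right (h1.trans (hf.fullGradient_lipschitz x y))
    (norm_pos_iff.2 (sub_ne_zero.2 hxy))

theorem convex_objective (hf : IsRegular f L μ) : ConvexOn ℝ Set.univ (objective f) := by
  refine ⟨convex_univ, fun x _ y _ a b ha hb hab => ?_⟩
  simp only [objective, smul_eq_mul]
  have h1 : ∑ i, f i (a • x + b • y) ≤ ∑ i, (a * f i x + b * f i y) :=
    Finset.sum_le_sum fun i _ => (hf.convex i).2 (Set.mem_univ x) (Set.mem_univ y) ha hb hab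
  rw [Finset.sum_add_distrib, ← Finset.mul_sum, ← Finset.mul_sum] at h1
  have h2 := mul_le_mul_of_nonneg_left h1 (show (0 : ℝ) ≤ 1 / (N : ℝ) by positivity)
  linarith

theorem strong_convex_objective [NeZero N] (hf : IsRegular f L μ) (x y : Vec d) :
    objective f y + inner ℝ (fullGradient f y) (x - y) + μ / 2 * ‖x - y‖ ^ 2 ≤ objective f x :=
  strong_convex_of_expanding hf.L_pos hf.mu_pos hf.hasGradientAt_objective hf.convex_objective
    hf.fullGradient_lipschitz (fun x y => by
      have h := hf.expanding x y
      rwa [(hf.hasGradientAt_objective x).gradient, (hf.hasGradientAt_objective y).gradient] at h)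
    x y

end IsRegular

/-! ### The proximal function: quadratic bounds, convexity and minimizer -/

theorem norm_sub_sq_expand {d : ℕ} (x u y : Vec d) :
    ‖x - y‖ ^ 2 = ‖u - y‖ ^ 2 + 2 * inner ℝ (u - y) (x - u) + ‖x - u‖ ^ 2 := by
  have : x - y = (u - y) + (x - u) := by abel
  rw [this, norm_add_sq_real]

theorem hasGradientAt_prox {d : ℕ} {g : Vec d → ℝ} {g' x : Vec d} (h : HasGradientAt g g' x)
    (σ : ℝ) (y : Vec d) :
    HasGradientAt (fun z => g z + σ / 2 * ‖z - y‖ ^ 2) (g' + σ • (x - y)) x := by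
  rw [hasGradientAt_iff_hasFDerivAt]
  have h1 := h.hasFDerivAt.add ((((hasFDerivAt_id x).sub_const y).norm_sq).const_mul (σ / 2))
  refine h1.congr_fderiv ?_
  ext v
  simp
  ring

/-- The gradient of the proximal function with proximal point `y`. -/
def proxGradient {N d : ℕ} (f : Fin N → Vec d → ℝ) (σ : ℝ) (y x : Vec d) : Vec d :=
  fullGradient f x + σ • (x - y)

namespace IsRegular

variable {N d : ℕ} {f : Fin N → Vec d → ℝ} {L μ σ : ℝ}

theorem gradient_proxComponent (hf : IsRegular f L μ) (σ : ℝ) (y : Vec d) (i : Fin N) (x : Vec d) :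
    gradient (proxComponent f σ y i) x = gradient (f i) x + σ • (x - y) :=
  (hasGradientAt_prox (hf.hasGradientAt i x) σ y).gradient

theorem continuous_objective (hf : IsRegular f L μ) : Continuous (objective f) :=
  continuous_iff_continuousAt.2 fun x => (hf.hasGradientAt_objective x).continuousAt

variable [NeZero N]

theorem fullGradient_proxComponent (hf : IsRegular f L μ) (σ : ℝ) (y x : Vec d) :
    fullGradient (proxComponent f σ y) x = proxGradient f σ y x := by
  have hN : (N : ℝ) ≠ 0 := Nat.cast_ne_zero.2 (NeZero.ne N)
  unfold proxGradient fullGradient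
  simp only [hf.gradient_proxComponent, Finset.sum_add_distrib, smul_add, Finset.sum_const,
    Finset.card_univ, Fintype.card_fin]
  congr 1
  rw [← Nat.cast_smul_eq_nsmul ℝ, smul_smul, one_div, inv_mul_cancel₀ hN, one_smul]

theorem prox_lower (hf : IsRegular f L μ) (σ : ℝ) (y x u : Vec d) :
    proxObjective f σ u y + inner ℝ (proxGradient f σ y u) (x - u) +
      (μ + σ) / 2 * ‖x - u‖ ^ 2 ≤ proxObjective f σ x y := by
  unfold proxObjective proxGradient
  have h := hf.strong_convex_objective x u
  rw [norm_sub_sq_expand x u y, inner_add_left, inner_smul_left]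
  simp only [conj_trivial]
  linarith

theorem prox_upper (hf : IsRegular f L μ) (σ : ℝ) (y x u : Vec d) :
    proxObjective f σ x y ≤ proxObjective f σ u y + inner ℝ (proxGradient f σ y u) (x - u) +
      (L + σ) / 2 * ‖x - u‖ ^ 2 := by
  unfold proxObjective proxGradient
  have h := le_add_inner_of_lipschitz hf.hasGradientAt_objective hf.fullGradient_lipschitz u x
  rw [norm_sub_sq_expand x u y, inner_add_left, inner_smul_left]
  simp only [conj_trivial]
  linarith

theorem prox_combination (hf : IsRegular f L μ) (hσ : 0 ≤ σ) (y : Vec d)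
    {a b : ℝ} (ha : 0 ≤ a) (hb : 0 ≤ b) (hab : a + b = 1) (x u : Vec d) :
    proxObjective f σ (a • x + b • u) y ≤
      a * proxObjective f σ x y + b * proxObjective f σ u y := by
  have h := strong_convex_combination (f := fun x => proxObjective f σ x y)
    (fun x u => hf.prox_lower σ y x u) ha hb hab x u
  have h1 : 0 ≤ (μ + σ) / 2 * (a * b) * ‖x - u‖ ^ 2 := by
    have := hf.mu_pos
    positivity
  linarith

/-- The proximal function has a minimizer. -/
theorem exists_prox_min (hf : IsRegular f L μ) (hσ : 0 ≤ σ) (y : Vec d) :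
    ∃ p, (∀ x, proxObjective f σ p y ≤ proxObjective f σ x y) ∧ proxGradient f σ y p = 0 ∧
      proxMin f σ y = proxObjective f σ p y := by
  have hcont : Continuous fun x => proxObjective f σ x y := by
    have := hf.continuous_objective
    unfold proxObjective
    fun_prop
  have hlim : Filter.Tendsto (fun x => proxObjective f σ x y) (Filter.cocompact (Vec d))
      Filter.atTop := by
    set c := ‖proxGradient f σ y 0‖
    -- Coercivity comes from the strong convexity bound based at the origin.
    have h1 : ∀ x : Vec d, ‖x‖ * (μ / 2 * ‖x‖ - c) + proxObjective f σ 0 y ≤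
        proxObjective f σ x y := by
      intro x
      have h2 := hf.prox_lower σ y x 0
      rw [sub_zero] at h2
      have h3 := neg_le_of_abs_le (abs_real_inner_le_norm (proxGradient f σ y 0) x)
      nlinarith [mul_nonneg hσ (sq_nonneg ‖x‖)]
    refine Filter.tendsto_atTop_mono h1 (Filter.tendsto_atTop_add_const_right _ _ ?_)
    have h4 := tendsto_norm_cocompact_atTop (E := Vec d)
    refine h4.atTop_mul_atTop₀ (Filter.tendsto_atTop_add_const_right _ _ ?_)
    exact h4.const_mul_atTop (half_pos hf.mu_pos)
  obtain ⟨p, hp⟩ := hcont.exists_forall_le hlim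
  refine ⟨p, hp, ?_, ?_⟩
  · have h1 : IsLocalMin (fun x => proxObjective f σ x y) p := Filter.Eventually.of_forall hp
    have h2 : HasGradientAt (fun x => proxObjective f σ x y) (proxGradient f σ y p) p :=
      hasGradientAt_prox (hf.hasGradientAt_objective p) σ y
    have h3 := h1.hasFDerivAt_eq_zero h2.hasFDerivAt
    simpa using h3
  · exact le_antisymm (ciInf_le ⟨_, by rintro _ ⟨x, rfl⟩; exact hp x⟩ p) (le_ciInf hp)

end IsRegular

/-! ### The stages of SVRG -/

/-- A variance is at most the second moment. -/
theorem sum_norm_sub_mean_sq_le {ι E : Type*} [Fintype ι] [Nonempty ι] [NormedAddCommGroup E]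
    [InnerProductSpace ℝ E] (a : ι → E) :
    ∑ i, ‖a i - (1 / (Fintype.card ι : ℝ)) • ∑ j, a j‖ ^ 2 ≤ ∑ i, ‖a i‖ ^ 2 := by
  have hN : (0 : ℝ) < Fintype.card ι := Nat.cast_pos.2 Fintype.card_pos
  set m := (1 / (Fintype.card ι : ℝ)) • ∑ j, a j with hm
  have h1 : ∑ i, inner ℝ (a i) m = Fintype.card ι * ‖m‖ ^ 2 := by
    have : ∑ i, a i = (Fintype.card ι : ℝ) • m := by
      rw [hm, smul_smul, mul_one_div_cancel hN.ne', one_smul]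
    rw [← sum_inner, this, inner_smul_left, real_inner_self_eq_norm_sq]
    simp
  simp only [norm_sub_sq_real, Finset.sum_add_distrib, Finset.sum_sub_distrib, ← Finset.mul_sum,
    h1, Finset.sum_const, Finset.card_univ, nsmul_eq_mul]
  nlinarith [mul_nonneg hN.le (sq_nonneg ‖m‖)]

namespace IsRegular

variable {N d : ℕ} [NeZero N] {f : Fin N → Vec d → ℝ} {L μ σ η : ℝ}

/-- The variance of the SVRG gradient estimator. -/
theorem variance_le (hf : IsRegular f L μ) (hσ : 0 ≤ σ) {y p : Vec d}
    (hp : proxGradient f σ y p = 0) (x xt : Vec d) :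
    (1 / (N : ℝ)) * ∑ i, ‖(gradient (f i) x - gradient (f i) xt) -
        (fullGradient f x - fullGradient f xt)‖ ^ 2 ≤
      4 * L * ((proxObjective f σ x y - proxObjective f σ p y) +
        (proxObjective f σ xt y - proxObjective f σ p y)) := by
  have hN : (0 : ℝ) < N := Nat.cast_pos.2 (NeZero.pos N)
  have hbreg : ∀ z : Vec d, (1 / (N : ℝ)) * ∑ i, ‖gradient (f i) z - gradient (f i) p‖ ^ 2 ≤
      2 * L * (proxObjective f σ z y - proxObjective f σ p y) := by
    intro z
    have h1 : ∑ i, ‖gradient (f i) z - gradient (f i) p‖ ^ 2 ≤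
        ∑ i, 2 * L * (f i z - f i p - inner ℝ (gradient (f i) p) (z - p)) :=
      Finset.sum_le_sum fun i _ => norm_sub_sq_le_of_convexOn hf.L_pos (hf.hasGradientAt i)
        (hf.convex i) (hf.smooth i).2 z p
    have h2 : (1 / (N : ℝ)) * ∑ i, 2 * L * (f i z - f i p - inner ℝ (gradient (f i) p) (z - p)) =
        2 * L * (objective f z - objective f p - inner ℝ (fullGradient f p) (z - p)) := by
      rw [← Finset.mul_sum, Finset.sum_sub_distrib, Finset.sum_sub_distrib, ← sum_inner]
      simp only [objective, fullGradient, inner_smul_left, conj_trivial]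
      ring
    -- Since the proximal gradient vanishes at `p`, the two sides differ by exactly `σ/2 ‖z - p‖²`.
    -- Only the smoothness `L` of the `f_i` enters, not `L + σ`.
    have h3 : objective f z - objective f p - inner ℝ (fullGradient f p) (z - p) ≤
        proxObjective f σ z y - proxObjective f σ p y := by
      unfold proxObjective proxGradient at *
      rw [norm_sub_sq_expand z p y, eq_neg_of_add_eq_zero_left hp, inner_neg_left, inner_smul_left]
      simp only [conj_trivial]
      nlinarith [mul_nonneg hσ (sq_nonneg ‖z - p‖)]
    calc _ ≤ _ := mul_le_mul_of_nonneg_left h1 (by positivity)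
      _ = _ := h2
      _ ≤ _ := mul_le_mul_of_nonneg_left h3 (by have := hf.L_pos; positivity)
  have h1 := sum_norm_sub_mean_sq_le fun i => gradient (f i) x - gradient (f i) xt
  rw [Fintype.card_fin, Finset.sum_sub_distrib, smul_sub] at h1
  have h2 : ∑ i, ‖gradient (f i) x - gradient (f i) xt‖ ^ 2 ≤
      ∑ i, (2 * ‖gradient (f i) x - gradient (f i) p‖ ^ 2 +
        2 * ‖gradient (f i) xt - gradient (f i) p‖ ^ 2) := by
    refine Finset.sum_le_sum fun i _ => ?_
    have h3 : gradient (f i) x - gradient (f i) xt =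
        (gradient (f i) x - gradient (f i) p) - (gradient (f i) xt - gradient (f i) p) := by abel
    rw [h3]
    set u := gradient (f i) x - gradient (f i) p
    set v := gradient (f i) xt - gradient (f i) p
    have h4 := parallelogram_law_with_norm ℝ u v
    nlinarith [sq_nonneg ‖u + v‖]
  rw [Finset.sum_add_distrib, ← Finset.mul_sum, ← Finset.mul_sum] at h2
  have h3 := mul_le_mul_of_nonneg_left (h1.trans h2) (show (0 : ℝ) ≤ 1 / (N : ℝ) by positivity)
  have h4 := hbreg x
  have h5 := hbreg xt
  unfold fullGradient
  linarith

/-- One gradient step with gradient error `e`. -/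
theorem perturbed_step (hf : IsRegular f L μ) (hσ : 0 ≤ σ) (hη : 0 < η) (hη1 : η * (L + σ) ≤ 1)
    (y p x e : Vec d) :
    2 * η * (proxObjective f σ (x - η • (proxGradient f σ y x + e)) y - proxObjective f σ p y) +
      ‖x - η • (proxGradient f σ y x + e) - p‖ ^ 2 ≤
    ‖x - p‖ ^ 2 - 2 * η * inner ℝ e (x - η • proxGradient f σ y x - p) + 2 * η ^ 2 * ‖e‖ ^ 2 := by
  set g := proxGradient f σ y x with hg
  set v := g + e with hv
  set w := x - η • v with hw
  have h1 := hf.prox_upper σ y w x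
  have h2 := hf.prox_lower σ y p x
  rw [← hg] at h1 h2
  have hwx : w - x = -(η • v) := by rw [hw]; abel
  have h3 : inner ℝ g (w - x) = -η * inner ℝ g v := by
    rw [hwx, inner_neg_right, inner_smul_right]; ring
  have h4 : ‖w - x‖ ^ 2 = η ^ 2 * ‖v‖ ^ 2 := by
    rw [hwx, norm_neg, norm_smul, mul_pow, Real.norm_eq_abs, sq_abs]
  have h5 : ‖w - p‖ ^ 2 = ‖x - p‖ ^ 2 - 2 * η * inner ℝ v (x - p) + η ^ 2 * ‖v‖ ^ 2 := by
    have : w - p = (x - p) - η • v := by rw [hw]; abel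
    rw [this, norm_sub_sq_real, inner_smul_right, real_inner_comm, norm_smul, mul_pow,
      Real.norm_eq_abs, sq_abs]
    ring
  have h6 : inner ℝ g (p - x) = -inner ℝ g (x - p) := by
    rw [← inner_neg_right, neg_sub]
  have h7 : inner ℝ v (x - p) = inner ℝ g (x - p) + inner ℝ e (x - p) := by
    rw [hv, inner_add_left]
  -- The error is paired with the endpoint of the exact step, which does not depend on `e`; this
  -- term therefore averages to zero over the sampled index.
  have h8 : inner ℝ e (x - η • g - p) = inner ℝ e (x - p) - η * inner ℝ g e := by
    have : x - η • g - p = (x - p) - η • g := by abel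
    rw [this, inner_sub_right, inner_smul_right, real_inner_comm e g]
  have h9 : inner ℝ g v = ‖g‖ ^ 2 + inner ℝ g e := by
    rw [hv, inner_add_right, real_inner_self_eq_norm_sq]
  have h10 : ‖v‖ ^ 2 = ‖g‖ ^ 2 + 2 * inner ℝ g e + ‖e‖ ^ 2 := by
    rw [hv, norm_add_sq_real]
  have h11 : 0 ≤ (μ + σ) / 2 * ‖p - x‖ ^ 2 := by have := hf.mu_pos; positivity
  have h12 : (L + σ) / 2 * ‖w - x‖ ^ 2 * (2 * η) ≤ η ^ 2 * ‖v‖ ^ 2 := by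
    rw [h4]
    have := mul_le_mul_of_nonneg_right hη1 (show 0 ≤ η ^ 2 * ‖v‖ ^ 2 by positivity)
    linarith
  have h13 : proxObjective f σ w y - proxObjective f σ p y ≤
      inner ℝ g (x - p) - η * inner ℝ g v + (L + σ) / 2 * ‖w - x‖ ^ 2 := by
    linarith
  have h14 := mul_le_mul_of_nonneg_left h13 (show 0 ≤ 2 * η by positivity)
  rw [h5, h7, h8]
  rw [h9] at h14
  rw [h10] at h12 ⊢
  nlinarith

/-- One iterative update of SVRG in expectation. -/
theorem svrg_step (hf : IsRegular f L μ) (hσ : 0 ≤ σ) (hη : 0 < η) (hη1 : η * (L + σ) ≤ 1)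
    (hη2 : η * L ≤ 1 / 16) {y p : Vec d} (hp : proxGradient f σ y p = 0)
    (hmin : ∀ z, proxObjective f σ p y ≤ proxObjective f σ z y) (x xt : Vec d) :
    (1 / (N : ℝ)) * ∑ i,
      (2 * η * (proxObjective f σ (x - η • (gradient (proxComponent f σ y i) x -
          gradient (proxComponent f σ y i) xt + fullGradient (proxComponent f σ y) xt)) y -
          proxObjective f σ p y) +
        ‖x - η • (gradient (proxComponent f σ y i) x -
          gradient (proxComponent f σ y i) xt + fullGradient (proxComponent f σ y) xt) - p‖ ^ 2) ≤
    ‖x - p‖ ^ 2 + η / 2 * ((proxObjective f σ x y - proxObjective f σ p y) +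
        (proxObjective f σ xt y - proxObjective f σ p y)) := by
  have hN : (0 : ℝ) < N := Nat.cast_pos.2 (NeZero.pos N)
  set e : Fin N → Vec d := fun i => (gradient (f i) x - gradient (f i) xt) -
        (fullGradient f x - fullGradient f xt) with he
  have h1 : ∀ i, gradient (proxComponent f σ y i) x -
      gradient (proxComponent f σ y i) xt + fullGradient (proxComponent f σ y) xt =
      proxGradient f σ y x + e i := by
    intro i
    rw [hf.gradient_proxComponent, hf.gradient_proxComponent, hf.fullGradient_proxComponent]
    simp only [he, proxGradient]
    module
  simp only [h1]
  have h2 := Finset.sum_le_sum fun i (_ : i ∈ Finset.univ) =>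
    hf.perturbed_step hσ hη hη1 y p x (e i)
  have hsum : ∑ i, e i = 0 := by
    simp only [he, Finset.sum_sub_distrib, Finset.sum_const, Finset.card_univ, Fintype.card_fin]
    unfold fullGradient
    rw [← smul_sub, ← smul_sub, ← Nat.cast_smul_eq_nsmul ℝ, smul_smul, mul_one_div_cancel hN.ne', one_smul,
      sub_self]
  have h3 : ∑ i, (‖x - p‖ ^ 2 - 2 * η * inner ℝ (e i) (x - η • proxGradient f σ y x - p) +
      2 * η ^ 2 * ‖e i‖ ^ 2) = N * ‖x - p‖ ^ 2 + 2 * η ^ 2 * ∑ i, ‖e i‖ ^ 2 := by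
    rw [Finset.sum_add_distrib, Finset.sum_sub_distrib, ← Finset.mul_sum, ← Finset.mul_sum,
      ← sum_inner, hsum]
    simp
  rw [h3] at h2
  have h4 := mul_le_mul_of_nonneg_left h2 (show (0 : ℝ) ≤ 1 / (N : ℝ) by positivity)
  refine h4.trans ?_
  have h5 := hf.variance_le hσ hp x xt
  have h6 : 1 / (N : ℝ) * (N * ‖x - p‖ ^ 2 + 2 * η ^ 2 * ∑ i, ‖e i‖ ^ 2) =
      ‖x - p‖ ^ 2 + 2 * η ^ 2 * ((1 / (N : ℝ)) * ∑ i, ‖e i‖ ^ 2) := by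
    field_simp
  rw [h6]
  have h7 := mul_le_mul_of_nonneg_left h5 (show 0 ≤ 2 * η ^ 2 by positivity)
  set Δ := (proxObjective f σ x y - proxObjective f σ p y) +
        (proxObjective f σ xt y - proxObjective f σ p y) with hΔ
  have hΔ0 : 0 ≤ Δ := by
    have := hmin x
    have := hmin xt
    linarith
  -- The variance term is `2η²·4LΔ`, at most `(η/2)Δ` since `ηL ≤ 1/16`.
  have h8 := mul_le_mul_of_nonneg_right hη2 (show 0 ≤ 8 * η * Δ by positivity)
  linarith

/-- The Lyapunov function of a stage grows by at most `η/2` times the initial error per update. -/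
theorem svrg_lyapunov (hf : IsRegular f L μ) (hσ : 0 ≤ σ) (hη : 0 < η) (hη1 : η * (L + σ) ≤ 1)
    (hη2 : η * L ≤ 1 / 16) {y p : Vec d} (hp : proxGradient f σ y p = 0)
    (hmin : ∀ z, proxObjective f σ p y ≤ proxObjective f σ z y) (xt : Vec d) (t : ℕ) :
    expect (iidInner (proxComponent f σ y) η xt (fullGradient (proxComponent f σ y) xt) t)
      (fun z => 3 / 2 * η * t * (proxObjective f σ z.2 y - proxObjective f σ p y) +
        ‖z.1 - p‖ ^ 2 + η / 2 * (proxObjective f σ z.1 y - proxObjective f σ p y)) ≤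
    ‖xt - p‖ ^ 2 + η / 2 * (t + 1) * (proxObjective f σ xt y - proxObjective f σ p y) := by
  induction t with
  | zero =>
    simp [iidInner, expect_pure]
  | succ t ih =>
    simp only [iidInner]
    have hfin := iidInner_support_finite (proxComponent f σ y) η xt
      (fullGradient (proxComponent f σ y) xt) t
    rw [expect_bind _ _ _ hfin fun _ => finite_support_map _ _ (Set.toFinite _)]
    have hstep : ∀ z : Vec d × Vec d, expect ((PMF.uniformOfFintype (Fin N)).map fun i =>
        (z.1 - η • (gradient (proxComponent f σ y i) z.1 - gradient (proxComponent f σ y i) xt +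
            fullGradient (proxComponent f σ y) xt),
          (1 / ((t : ℝ) + 1)) • (z.1 - η • (gradient (proxComponent f σ y i) z.1 -
            gradient (proxComponent f σ y i) xt + fullGradient (proxComponent f σ y) xt) +
              (t : ℝ) • z.2)))
        (fun z => 3 / 2 * η * ((t + 1 : ℕ) : ℝ) *
          (proxObjective f σ z.2 y - proxObjective f σ p y) + ‖z.1 - p‖ ^ 2 +
          η / 2 * (proxObjective f σ z.1 y - proxObjective f σ p y)) ≤
        (3 / 2 * η * t * (proxObjective f σ z.2 y - proxObjective f σ p y) +
        ‖z.1 - p‖ ^ 2 + η / 2 * (proxObjective f σ z.1 y - proxObjective f σ p y)) +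
        η / 2 * (proxObjective f σ xt y - proxObjective f σ p y) := by
      rintro ⟨x, xbar⟩
      have hN : (0 : ℝ) < N := Nat.cast_pos.2 (NeZero.pos N)
      rw [expect_map _ _ _ (Set.toFinite _), expect_uniform, Fintype.card_fin]
      have h1 := hf.svrg_step hσ hη hη1 hη2 hp hmin x xt
      simp only
      set X : Fin N → Vec d := fun i => x - η • (gradient (proxComponent f σ y i) x -
        gradient (proxComponent f σ y i) xt + fullGradient (proxComponent f σ y) xt) with hX
      -- The weight `2η` of the new error is split: `3η/2` goes into the running average by
      -- convexity, and `η/2` pays for the variance of the next update.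
      have h2 : ∀ i, 3 / 2 * η * ((t + 1 : ℕ) : ℝ) *
          (proxObjective f σ ((1 / ((t : ℝ) + 1)) • (X i + (t : ℝ) • xbar)) y -
            proxObjective f σ p y) + ‖X i - p‖ ^ 2 +
          η / 2 * (proxObjective f σ (X i) y - proxObjective f σ p y) ≤
          3 / 2 * η * t * (proxObjective f σ xbar y - proxObjective f σ p y) +
          (2 * η * (proxObjective f σ (X i) y - proxObjective f σ p y) + ‖X i - p‖ ^ 2) := by
        intro i
        have ht : (0 : ℝ) < (t : ℝ) + 1 := by positivity
        have h3 := hf.prox_combination hσ y (a := 1 / ((t : ℝ) + 1)) (b := t / ((t : ℝ) + 1))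
          (by positivity) (by positivity) (by field_simp; ring) (X i) xbar
        have h4 : (1 / ((t : ℝ) + 1)) • (X i + (t : ℝ) • xbar) =
            (1 / ((t : ℝ) + 1)) • X i + (t / ((t : ℝ) + 1)) • xbar := by
          rw [smul_add, smul_smul, div_mul_eq_mul_div, one_mul]
        rw [h4]
        have h5 := mul_le_mul_of_nonneg_left h3 ht.le
        have h6 : ((t : ℝ) + 1) * (1 / ((t : ℝ) + 1) * proxObjective f σ (X i) y +
            t / ((t : ℝ) + 1) * proxObjective f σ xbar y) =
            proxObjective f σ (X i) y + t * proxObjective f σ xbar y := by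
          field_simp
        rw [h6] at h5
        have h7 := mul_le_mul_of_nonneg_left h5 (show 0 ≤ 3 / 2 * η by positivity)
        push_cast
        linarith
      have h3 := Finset.sum_le_sum fun i (_ : i ∈ Finset.univ) => h2 i
      rw [Finset.sum_add_distrib (f := fun _ => 3 / 2 * η * t *
        (proxObjective f σ xbar y - proxObjective f σ p y)), Finset.sum_const, Finset.card_univ,
        Fintype.card_fin, nsmul_eq_mul] at h3
      have h4 := mul_le_mul_of_nonneg_left h3 (show (0 : ℝ) ≤ 1 / (N : ℝ) by positivity)
      refine h4.trans ?_
      rw [mul_add, ← mul_assoc, one_div_mul_cancel hN.ne', one_mul]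
      linarith
    refine (expect_mono _ hfin hstep).trans ?_
    rw [expect_add_const _ _ _ hfin]
    push_cast
    linarith

/-- A stage decreases the expected error of the proximal function by a constant factor. -/
theorem svrg_stage (hf : IsRegular f L μ) (hσ : 0 ≤ σ) (hη : 0 < η) (hη1 : η * (L + σ) ≤ 1)
    (hη2 : η * L ≤ 1 / 16) {T : ℕ} (hT0 : 0 < T)
    (hT : μ ≤ L → 96 ≤ T) (hTη : 6 ≤ η * T * (μ + σ)) {y p : Vec d}
    (hp : proxGradient f σ y p = 0)
    (hmin : ∀ z, proxObjective f σ p y ≤ proxObjective f σ z y) (xt : Vec d) :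
    expect ((iidInner (proxComponent f σ y) η xt (fullGradient (proxComponent f σ y) xt) T).map
      Prod.snd) (fun x => proxObjective f σ x y - proxObjective f σ p y) ≤
    (8 / 9) ^ 4 * (proxObjective f σ xt y - proxObjective f σ p y) := by
  have hfin := iidInner_support_finite (proxComponent f σ y) η xt
      (fullGradient (proxComponent f σ y) xt) T
  rw [expect_map _ _ _ hfin]
  set D := iidInner (proxComponent f σ y) η xt (fullGradient (proxComponent f σ y) xt) T
  set e := expect D fun z => proxObjective f σ z.2 y - proxObjective f σ p y
  have hT1 : (0 : ℝ) < T := Nat.cast_pos.2 hT0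
  have h1 : 3 / 2 * η * T * e ≤ ‖xt - p‖ ^ 2 +
      η / 2 * (T + 1) * (proxObjective f σ xt y - proxObjective f σ p y) := by
    refine le_trans ?_ (hf.svrg_lyapunov hσ hη hη1 hη2 hp hmin xt T)
    rw [← expect_const_mul]
    refine expect_mono _ hfin fun z => ?_
    have h2 : 0 ≤ η / 2 * (proxObjective f σ z.1 y - proxObjective f σ p y) :=
      mul_nonneg (by positivity) (by linarith [hmin z.1])
    linarith [sq_nonneg ‖z.1 - p‖]
  set δ := proxObjective f σ xt y - proxObjective f σ p y with hδ
  have h2 : (μ + σ) / 2 * ‖xt - p‖ ^ 2 ≤ δ := by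
    have h := hf.prox_lower σ y xt p
    rw [hp, inner_zero_left] at h
    linarith
  have hδ0 : 0 ≤ δ := by linarith [hmin xt]
  have h3 : 3 * ‖xt - p‖ ^ 2 ≤ η * T * δ := by
    have h4 := mul_le_mul_of_nonneg_left h2 (show 0 ≤ η * T by positivity)
    have h5 := mul_le_mul_of_nonneg_right hTη (show 0 ≤ ‖xt - p‖ ^ 2 / 2 by positivity)
    linarith
  -- Makes the extra `1` in `T + 1` harmless. The total factor is `(2/3)(1/3 + 1/2 + 1/192)`, below
  -- `(8/9)^4`.
  have h4 : η * δ * 96 ≤ η * δ * T := by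
    by_cases hxp : xt = p
    · simp [hδ, hxp]
    · have hT' : (96 : ℝ) ≤ T := by exact_mod_cast hT (hf.mu_le_of_ne hxp)
      exact mul_le_mul_of_nonneg_left hT' (by positivity)
  have h5 : (η * T) * e ≤ (η * T) * ((8 / 9) ^ 4 * δ) := by
    have : 0 ≤ η * T * δ := by positivity
    norm_num
    nlinarith
  exact le_of_mul_le_mul_left h5 (by positivity)

/-- The error after `K` stages. -/
theorem svrg_stages (hf : IsRegular f L μ) (hσ : 0 ≤ σ) (hη : 0 < η) (hη1 : η * (L + σ) ≤ 1)
    (hη2 : η * L ≤ 1 / 16) {T : ℕ} (hT0 : 0 < T)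
    (hT : μ ≤ L → 96 ≤ T) (hTη : 6 ≤ η * T * (μ + σ)) {y p : Vec d}
    (hp : proxGradient f σ y p = 0)
    (hmin : ∀ z, proxObjective f σ p y ≤ proxObjective f σ z y) (x : Vec d) (K : ℕ) :
    expect (iidStage (fullGradient (proxComponent f σ y)) (proxComponent f σ y) η T x K)
      (fun x => proxObjective f σ x y - proxObjective f σ p y) ≤
    ((8 / 9) ^ 4) ^ K * (proxObjective f σ x y - proxObjective f σ p y) := by
  induction K with
  | zero => simp [iidStage, expect_pure]
  | succ K ih =>
    simp only [iidStage]
    have hfin := iidStage_support_finite (fullGradient (proxComponent f σ y))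
      (proxComponent f σ y) η T x K
    rw [expect_bind _ _ _ hfin
      fun _ => finite_support_map _ _ (iidInner_support_finite _ _ _ _ _)]
    refine (expect_mono _ hfin fun x' =>
      hf.svrg_stage hσ hη hη1 hη2 hT0 hT hTη hp hmin x').trans ?_
    rw [expect_const_mul, pow_succ' _ K, mul_assoc]
    exact mul_le_mul_of_nonneg_left ih (by positivity)

end IsRegular

/-! ### The accelerated outer iteration -/

/-- The start `√q` is a fixed point of the recursion, so the momentum is constant. -/
theorem alpha_eq {q : ℝ} (hq : 0 < q) (p : ℕ) : alpha q p = √q := by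
  induction p with
  | zero => rfl
  | succ p ih =>
    have hs : 0 < √q := Real.sqrt_pos.2 hq
    have hs2 : √q ^ 2 = q := Real.sq_sqrt hq.le
    rw [alpha, ih]
    refine (eq_posRoot q (√q) (√q) hs.ne' hs ?_).symm
    linear_combination √q * hs2

theorem betaNext_eq {q : ℝ} (hq : 0 < q) (p : ℕ) : betaNext q p = (1 - √q) / (1 + √q) := by
  have hs : 0 < √q := Real.sqrt_pos.2 hq
  unfold betaNext
  rw [alpha_eq hq, alpha_eq hq]
  field_simp
  ring

/-- The Lyapunov function of the outer iteration; `a` is `√q`. -/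
def outerLyapunov {N d : ℕ} (f : Fin N → Vec d → ℝ) (μ a : ℝ) (xs x y : Vec d) : ℝ :=
  objective f x - objective f xs + μ / 2 * ‖x + ((1 + a) / a) • (y - x) - xs‖ ^ 2

namespace IsRegular

variable {N d : ℕ} {f : Fin N → Vec d → ℝ} {L μ σ η a : ℝ} {xs : Vec d}

theorem objective_sub_le_outerLyapunov (hf : IsRegular f L μ) (x y : Vec d) :
    objective f x - objective f xs ≤ outerLyapunov f μ a xs x y := by
  have h : 0 ≤ μ / 2 * ‖x + ((1 + a) / a) • (y - x) - xs‖ ^ 2 := by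
    have := hf.mu_pos
    positivity
  unfold outerLyapunov
  linarith

variable [NeZero N]

theorem objective_growth (hf : IsRegular f L μ) (hxs : ∀ x, objective f xs ≤ objective f x)
    (x : Vec d) : μ / 2 * ‖x - xs‖ ^ 2 ≤ objective f x - objective f xs := by
  have h1 : IsLocalMin (objective f) xs := Filter.Eventually.of_forall hxs
  have h2 := h1.hasFDerivAt_eq_zero (hf.hasGradientAt_objective xs).hasFDerivAt
  have h3 : fullGradient f xs = 0 := by simpa using h2
  have h4 := hf.strong_convex_objective x xs
  rw [h3, inner_zero_left] at h4
  linarith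

/-- The subproblem's strong convexity at its minimizer `p` is tested at `z = (1 - a) x + a x*`. The
momentum is such that `x' - z` is `a` times the new auxiliary vector, and `a²(μ + σ) = μ` turns its
square into the new potential term. -/
theorem outerLyapunov_step (hf : IsRegular f L μ) (hσ : 0 ≤ σ) (ha : 0 < a) (ha1 : a ≤ 1)
    (haq : a ^ 2 * (μ + σ) = μ) (hxs : ∀ x, objective f xs ≤ objective f x) {y p : Vec d}
    (hp : proxGradient f σ y p = 0) (x x' : Vec d) :
    (1 - a / 4) * outerLyapunov f μ a xs x' (x' + ((1 - a) / (1 + a)) • (x' - x)) ≤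
      (1 - a) * outerLyapunov f μ a xs x y +
        4 / a * (proxObjective f σ x' y - proxObjective f σ p y) := by
  have hμ := hf.mu_pos
  have hl : 0 < μ + σ := by linarith
  set A := x + ((1 + a) / a) • (y - x) - xs with hA
  set B := x - xs with hB
  set V := x' + ((1 + a) / a) • (x' + ((1 - a) / (1 + a)) • (x' - x) - x') - xs with hV
  set z := (1 - a) • x + a • xs with hz
  have h1 := hf.prox_lower σ y z p
  rw [hp, inner_zero_left, add_zero] at h1
  have h2 := hf.prox_lower σ y x' p
  rw [hp, inner_zero_left, add_zero] at h2
  have h3 := strong_convex_combination hf.strong_convex_objective (sub_nonneg.2 ha1) ha.le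
    (sub_add_cancel 1 a) x xs
  rw [← hz, ← hB] at h3
  have ha' : 1 + a ≠ 0 := by positivity
  have hzx : z - x' = -(a • V) := by
    have : a • V = x' - z := by
      rw [hV, hz, add_sub_cancel_left, smul_smul, smul_sub, smul_add, smul_smul]
      have h : a * ((1 + a) / a * ((1 - a) / (1 + a))) = 1 - a := by field_simp
      rw [h]
      module
    rw [this]
    abel
  have hzy : z - y = -((a / (1 + a)) • (A + a • B)) := by
    have h : (1 + a) • (z - y) = -(a • (A + a • B)) := by
      have h : a • (((1 + a) / a) • (y - x)) = (1 + a) • (y - x) := by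
        rw [smul_smul, mul_div_cancel₀ _ ha.ne']
      have h' : a • (A + a • B) = a • (((1 + a) / a) • (y - x)) +
          a • (x - xs + a • (x - xs)) := by
        rw [hA, hB]
        module
      rw [h', h, hz]
      module
    have h' : z - y = (1 / (1 + a)) • (1 + a) • (z - y) := by
      rw [smul_smul, one_div_mul_cancel ha', one_smul]
    rw [h', h, smul_neg, smul_smul, div_mul_eq_mul_div, one_mul]
  -- The term in `‖A‖²` belongs to the old potential; the one in `‖B‖²` is cancelled by the strong
  -- convexity gain in `h3`.
  have h4 : σ / 2 * ‖z - y‖ ^ 2 ≤ μ / 2 * (1 - a) * (‖A‖ ^ 2 + a * ‖B‖ ^ 2) := by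
    have h5 : ‖A + a • B‖ ^ 2 ≤ (1 + a) * (‖A‖ ^ 2 + a * ‖B‖ ^ 2) := by
      rw [norm_add_sq_real, inner_smul_right, norm_smul, mul_pow, Real.norm_eq_abs, sq_abs]
      have h6 : 0 ≤ ‖A - B‖ ^ 2 := sq_nonneg _
      rw [norm_sub_sq_real] at h6
      nlinarith [mul_nonneg ha.le h6]
    rw [hzy, norm_neg, norm_smul, mul_pow, Real.norm_eq_abs, sq_abs]
    have h6 := mul_le_mul_of_nonneg_left h5 (show 0 ≤ σ / 2 * (a / (1 + a)) ^ 2 by positivity)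
    have h7 : σ / 2 * (a / (1 + a)) ^ 2 * ((1 + a) * (‖A‖ ^ 2 + a * ‖B‖ ^ 2)) =
        μ / 2 * (1 - a) * (‖A‖ ^ 2 + a * ‖B‖ ^ 2) := by
      have h8 : σ * a ^ 2 = μ * (1 - a) * (1 + a) := by linear_combination haq
      field_simp
      linear_combination (‖A‖ ^ 2 + a * ‖B‖ ^ 2) * h8
    linarith
  have h5 : ‖z - p‖ ^ 2 ≥ a ^ 2 * ‖V‖ ^ 2 - 2 * a * (‖V‖ * ‖x' - p‖) + ‖x' - p‖ ^ 2 := by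
    have h6 : z - p = (x' - p) - a • V := by
      have : z - p = (z - x') + (x' - p) := by abel
      rw [this, hzx]
      abel
    rw [h6, norm_sub_sq_real, inner_smul_right, norm_smul, mul_pow, Real.norm_eq_abs, sq_abs]
    have h7 := real_inner_le_norm (x' - p) V
    nlinarith [mul_le_mul_of_nonneg_left h7 ha.le]
  set E := ‖x' - p‖ with hE
  set v := ‖V‖ with hv
  set e := proxObjective f σ x' y - proxObjective f σ p y with he
  have h6 : (μ + σ) / 2 * E ^ 2 ≤ e := by linarith
  -- Young's inequality for the cross term caused by the inexact solution `x' ≠ p`; it accounts for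
  -- the loss `a/4` and the factor `4/a`.
  have h7 : (μ + σ) * a * (v * E) ≤ a / 4 * (μ / 2 * v ^ 2) + 4 / a * ((μ + σ) / 2 * E ^ 2) := by
    have h8 : a / 4 * (μ / 2 * v ^ 2) + 4 / a * ((μ + σ) / 2 * E ^ 2) - (μ + σ) * a * (v * E) =
        (μ + σ) / (8 * a) * (a ^ 2 * v - 4 * E) ^ 2 := by
      have h9 : (μ + σ) / (8 * a) * (a ^ 2 * v - 4 * E) ^ 2 = (μ + σ) * a ^ 3 / 8 * v ^ 2 -
          (μ + σ) * a * (v * E) + 4 / a * ((μ + σ) / 2 * E ^ 2) := by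
        field_simp
        ring
      rw [h9]
      linear_combination -(a * v ^ 2 / 8) * haq
    have h9 : 0 ≤ (μ + σ) / (8 * a) * (a ^ 2 * v - 4 * E) ^ 2 := by positivity
    linarith
  have h8 : 1 ≤ 4 / a := by rw [le_div_iff₀ ha]; linarith
  have h9 := mul_le_mul_of_nonneg_left h6 (sub_nonneg.2 h8)
  have h10 := mul_le_mul_of_nonneg_left h5 (show 0 ≤ (μ + σ) / 2 by positivity)
  have h11 : (μ + σ) / 2 * (a ^ 2 * v ^ 2) = μ / 2 * v ^ 2 := by
    linear_combination v ^ 2 / 2 * haq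
  have h12 : 0 ≤ a / 4 * (objective f x' - objective f xs) :=
    mul_nonneg (by positivity) (sub_nonneg.2 (hxs x'))
  have h13 : 0 ≤ σ / 2 * ‖x' - y‖ ^ 2 := by positivity
  unfold outerLyapunov
  rw [← hA, ← hV]
  unfold proxObjective at h1 he
  nlinarith

/-- The warm start is good because `x - y` is `a/(1+a)` times the difference of `x - x*` and `v -
x*`, both controlled by the potential, while `σa² ≤ μ`. -/
theorem prox_initial_error (hf : IsRegular f L μ) (hσ : 0 ≤ σ) (ha : 0 < a)
    (haq : a ^ 2 * (μ + σ) = μ) (hxs : ∀ x, objective f xs ≤ objective f x) (x y p : Vec d) :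
    proxObjective f σ x y - proxObjective f σ p y ≤ 3 * outerLyapunov f μ a xs x y := by
  have hμ := hf.mu_pos
  set A := x + ((1 + a) / a) • (y - x) - xs with hA
  set B := x - xs with hB
  have ha' : 1 + a ≠ 0 := by positivity
  have h1 : x - y = (a / (1 + a)) • (B - A) := by
    have : B - A = -(((1 + a) / a) • (y - x)) := by rw [hA, hB]; abel
    rw [this, smul_neg, smul_smul]
    have h : a / (1 + a) * ((1 + a) / a) = 1 := by field_simp
    rw [h, one_smul]
    abel
  have h2 : ‖B - A‖ ^ 2 ≤ 2 * (‖B‖ ^ 2 + ‖A‖ ^ 2) := by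
    have h3 := parallelogram_law_with_norm ℝ B A
    nlinarith [sq_nonneg ‖B + A‖]
  have h3 : σ / 2 * ‖x - y‖ ^ 2 ≤ μ * (‖B‖ ^ 2 + ‖A‖ ^ 2) := by
    rw [h1, norm_smul, mul_pow, Real.norm_eq_abs, sq_abs]
    have h4 : (a / (1 + a)) ^ 2 ≤ a ^ 2 :=
      pow_le_pow_left₀ (by positivity) (div_le_self ha.le (by linarith)) 2
    have h5 : σ / 2 * (a / (1 + a)) ^ 2 ≤ μ / 2 := by
      nlinarith [mul_le_mul_of_nonneg_left h4 (show 0 ≤ σ / 2 by positivity),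
        mul_nonneg (sq_nonneg a) hμ.le]
    calc σ / 2 * ((a / (1 + a)) ^ 2 * ‖B - A‖ ^ 2) =
        σ / 2 * (a / (1 + a)) ^ 2 * ‖B - A‖ ^ 2 := by ring
      _ ≤ μ / 2 * (2 * (‖B‖ ^ 2 + ‖A‖ ^ 2)) :=
        mul_le_mul h5 h2 (sq_nonneg _) (by positivity)
      _ = _ := by ring
  have h4 := hf.objective_growth hxs x
  have h5 : 0 ≤ σ / 2 * ‖p - y‖ ^ 2 := by positivity
  have h6 : 0 ≤ μ / 2 * ‖A‖ ^ 2 := by positivity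
  have h7 := hxs p
  unfold outerLyapunov proxObjective
  rw [← hA]
  rw [← hB] at h4
  linarith

/-- The expected Lyapunov function decreases by the factor `1 - √q/2` per outer iteration. -/
theorem expect_outerLyapunov_le (hf : IsRegular f L μ) (hσ : 0 ≤ σ) (hη : 0 < η)
    (hη1 : η * (L + σ) ≤ 1) (hη2 : η * L ≤ 1 / 16) {T K : ℕ} (hT0 : 0 < T)
    (hT : μ ≤ L → 96 ≤ T) (hTη : 6 ≤ η * T * (μ + σ))
    (hxs : ∀ x, objective f xs ≤ objective f x) (ha : √(ratio μ σ) = a)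
    (hK : ((8 / 9 : ℝ) ^ 4) ^ K ≤ a ^ 2 / 48) (x0 : Vec d) (p : ℕ) :
    expect (iidOuter fullGradient f μ σ η T K x0 p)
      (fun s => outerLyapunov f μ a xs s.1 s.2.1) ≤
    (1 - a / 2) ^ p * outerLyapunov f μ a xs x0 x0 := by
  have hμ := hf.mu_pos
  have hl : 0 < μ + σ := by linarith
  have hq : 0 < ratio μ σ := by unfold ratio; positivity
  have ha0 : 0 < a := ha ▸ Real.sqrt_pos.2 hq
  have ha2 : a ^ 2 = ratio μ σ := by rw [← ha, Real.sq_sqrt hq.le]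
  have haq : a ^ 2 * (μ + σ) = μ := by rw [ha2, ratio, div_mul_cancel₀ _ hl.ne']
  have ha1 : a ≤ 1 := by
    rw [← ha]
    exact Real.sqrt_le_one.2 ((div_le_one hl).2 (by linarith))
  induction p with
  | zero => simp [iidOuter, expect_pure]
  | succ p ih =>
    simp only [iidOuter]
    have hfin := iidOuter_support_finite fullGradient f μ σ η T K x0 p
    rw [expect_bind _ _ _ hfin
      fun _ => finite_support_map _ _ (iidStage_support_finite _ _ _ _ _ _)]
    have hstep : ∀ s : Vec d × Vec d × Vec d, expect ((iidStage
        (fullGradient (proxComponent f σ s.2.1)) (proxComponent f σ s.2.1) η T s.1 K).map fun x =>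
        (x, x + betaNext (ratio μ σ) p • (x - s.1), s.2.1))
        (fun s => outerLyapunov f μ a xs s.1 s.2.1) ≤
        (1 - a / 2) * outerLyapunov f μ a xs s.1 s.2.1 := by
      rintro ⟨x, y, y'⟩
      simp only
      have hfin' := iidStage_support_finite (fullGradient (proxComponent f σ y))
        (proxComponent f σ y) η T x K
      rw [expect_map _ _ _ hfin', betaNext_eq hq, ha]
      obtain ⟨z, hz1, hz2, -⟩ := hf.exists_prox_min hσ y
      have h1 := hf.svrg_stages hσ hη hη1 hη2 hT0 hT hTη hz2 hz1 x K
      have h2 := expect_mono (iidStage (fullGradient (proxComponent f σ y))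
        (proxComponent f σ y) η T x K) hfin' fun x' =>
        hf.outerLyapunov_step hσ ha0 ha1 haq hxs hz2 x x'
      simp only [add_comm ((1 - a) * _)] at h2
      rw [expect_add_const _ _ _ hfin', expect_const_mul, expect_const_mul] at h2
      set W := outerLyapunov f μ a xs x y with hW
      have h3 := hf.prox_initial_error hσ ha0 haq hxs x y z
      rw [← hW] at h3
      have hW0 : 0 ≤ W := (sub_nonneg.2 (hxs x)).trans (hf.objective_sub_le_outerLyapunov x y)
      have h4 := h1.trans (mul_le_mul_of_nonneg_left h3 (by positivity))
      have h5 := mul_le_mul_of_nonneg_right hK (show 0 ≤ 3 * W by positivity)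
      have h6 := mul_le_mul_of_nonneg_left (h4.trans h5) (show 0 ≤ 4 / a by positivity)
      have h7 : 4 / a * (a ^ 2 / 48 * (3 * W)) = a / 4 * W := by
        field_simp
        ring
      rw [h7] at h6
      refine le_of_mul_le_mul_left (h2.trans ?_) (show 0 < 1 - a / 4 by linarith)
      -- The solver error contributes `(a/4)W`, and `1 - 3a/4 ≤ (1 - a/4)(1 - a/2)`.
      nlinarith [mul_nonneg (sq_nonneg a) hW0]
    refine (expect_mono _ hfin hstep).trans ?_
    rw [expect_const_mul, pow_succ' _ p, mul_assoc]
    exact mul_le_mul_of_nonneg_left ih (by linarith)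

/-- The expected error of the approximate solution of a proximal subproblem. -/
theorem expect_prox_error_le (hf : IsRegular f L μ) (hσ : 0 ≤ σ) (hη : 0 < η)
    (hη1 : η * (L + σ) ≤ 1) (hη2 : η * L ≤ 1 / 16) {T K : ℕ} (hT0 : 0 < T)
    (hT : μ ≤ L → 96 ≤ T) (hTη : 6 ≤ η * T * (μ + σ))
    (hxs : ∀ x, objective f xs ≤ objective f x) (ha : √(ratio μ σ) = a)
    (hK : ((8 / 9 : ℝ) ^ 4) ^ K ≤ a ^ 2 / 48) (x0 : Vec d) (p : ℕ) :
    expect (iidOuter fullGradient f μ σ η T K x0 (p + 1))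
      (fun s => proxObjective f σ s.1 s.2.2 - proxMin f σ s.2.2) ≤
    ((8 / 9) ^ 4) ^ K * 3 * ((1 - a / 2) ^ p * outerLyapunov f μ a xs x0 x0) := by
  have hμ := hf.mu_pos
  have hl : 0 < μ + σ := by linarith
  have hq : 0 < ratio μ σ := by unfold ratio; positivity
  have ha0 : 0 < a := ha ▸ Real.sqrt_pos.2 hq
  have ha2 : a ^ 2 = ratio μ σ := by rw [← ha, Real.sq_sqrt hq.le]
  have haq : a ^ 2 * (μ + σ) = μ := by rw [ha2, ratio, div_mul_cancel₀ _ hl.ne']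
  simp only [iidOuter]
  have hfin := iidOuter_support_finite fullGradient f μ σ η T K x0 p
  rw [expect_bind _ _ _ hfin
    fun _ => finite_support_map _ _ (iidStage_support_finite _ _ _ _ _ _)]
  refine (expect_mono (h := fun s => ((8 / 9) ^ 4) ^ K * 3 * outerLyapunov f μ a xs s.1 s.2.1)
    _ hfin ?_).trans ?_
  · rintro ⟨x, y, y'⟩
    simp only
    rw [expect_map _ _ _ (iidStage_support_finite _ _ _ _ _ _)]
    obtain ⟨z, hz1, hz2, hz3⟩ := hf.exists_prox_min hσ y
    simp only [hz3]
    refine (hf.svrg_stages hσ hη hη1 hη2 hT0 hT hTη hz2 hz1 x K).trans ?_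
    rw [mul_assoc]
    exact mul_le_mul_of_nonneg_left (hf.prox_initial_error hσ ha0 haq hxs x y z) (by positivity)
  · rw [expect_const_mul]
    exact mul_le_mul_of_nonneg_left
      (hf.expect_outerLyapunov_le hσ hη hη1 hη2 hT0 hT hTη hxs ha hK x0 p) (by positivity)

theorem outerLyapunov_initial_le (hf : IsRegular f L μ)
    (hxs : ∀ x, objective f xs ≤ objective f x) (x0 : Vec d) :
    outerLyapunov f μ a xs x0 x0 ≤ 2 * (objective f x0 - objective f xs) := by
  have h := hf.objective_growth hxs x0
  unfold outerLyapunov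
  rw [sub_self, smul_zero, add_zero]
  linarith

end IsRegular

/-! ### The parameters -/

theorem ratio_pos {μ σ : ℝ} (hμ : 0 < μ) (hσ : 0 ≤ σ) : 0 < ratio μ σ := by
  unfold ratio
  positivity

theorem ratio_le_one {μ σ : ℝ} (hμ : 0 < μ) (hσ : 0 ≤ σ) : ratio μ σ ≤ 1 :=
  (div_le_one (by linarith)).2 (by linarith)

/-- The number whose logarithm determines the number of stages, in terms of `a = √q`. -/
theorem stage_argument_eq {μ σ a : ℝ} (hμ : 0 < μ) (hσ : 0 ≤ σ) (ha : √(ratio μ σ) = a) :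
    4 / (2 - a) + 10368 * σ / (μ * ratio μ σ * (1 - a / 2) ^ 2) =
      4 / (2 - a) + 10368 * ((1 - a ^ 2) / (a ^ 4 * (1 - a / 2) ^ 2)) := by
  have hq := ratio_pos hμ hσ
  have hl : 0 < μ + σ := by linarith
  have ha2 : a ^ 2 = ratio μ σ := by rw [← ha, Real.sq_sqrt hq.le]
  have ha0 : 0 < a := ha ▸ Real.sqrt_pos.2 hq
  have ha1 : a ≤ 1 := by
    rw [← ha]
    exact Real.sqrt_le_one.2 (ratio_le_one hμ hσ)
  have haq : a ^ 2 * (μ + σ) = μ := by rw [ha2, ratio, div_mul_cancel₀ _ hl.ne']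
  have hr : (1 - a / 2) ≠ 0 := by linarith
  rw [← ha2, mul_div_assoc]
  congr 2
  rw [div_eq_div_iff (by positivity) (by positivity)]
  linear_combination (a ^ 2 * (1 - a / 2) ^ 2) * haq

/-- For `a` near 1 the term with `σ` may vanish, and `4/(2 - a) ≥ 10/3` suffices only thanks to the
fourth power. Otherwise `1 - a²` is bounded below and the `σ` term, of order `a⁻⁴`, suffices to the
first power. -/
theorem stage_contraction {μ σ a : ℝ} (hμ : 0 < μ) (hσ : 0 ≤ σ) (ha : √(ratio μ σ) = a) :
    ((8 / 9 : ℝ) ^ 4) ^ numStages μ σ ≤ a ^ 2 / 48 ∧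
      ((8 / 9 : ℝ) ^ 4) ^ numStages μ σ ≤ (1 - a / 2) / 27 := by
  have hq := ratio_pos hμ hσ
  have ha0 : 0 < a := ha ▸ Real.sqrt_pos.2 hq
  have ha1 : a ≤ 1 := by
    rw [← ha]
    exact Real.sqrt_le_one.2 (ratio_le_one hμ hσ)
  set K := numStages μ σ with hK
  set X := 4 / (2 - a) + 10368 * ((1 - a ^ 2) / (a ^ 4 * (1 - a / 2) ^ 2)) with hX
  have hlog : 0 < Real.log (9 / 8) := Real.log_pos (by norm_num)
  have h2a : 0 < 2 - a := by linarith
  have hr : 0 < 1 - a / 2 := by linarith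
  have h1a : 0 ≤ 1 - a ^ 2 := by nlinarith
  have hX1 : 0 < 4 / (2 - a) := by positivity
  have hX2 : 0 ≤ 10368 * ((1 - a ^ 2) / (a ^ 4 * (1 - a / 2) ^ 2)) := by positivity
  have hXpos : 0 < X := by linarith
  have hY : X ≤ (9 / 8) ^ K := by
    have h1 : 1 / Real.log (9 / 8) * Real.log X ≤ K := by
      rw [hK, numStages, ha, stage_argument_eq hμ hσ ha]
      exact Nat.le_ceil _
    rw [div_mul_eq_mul_div, one_mul, div_le_iff₀ hlog, ← Real.log_pow] at h1
    exact (Real.log_le_log_iff hXpos (by positivity)).1 h1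
  set Y : ℝ := (9 / 8) ^ K with hYdef
  have hY0 : 0 < Y := by positivity
  have hτ : ((8 / 9 : ℝ) ^ 4) ^ K = 1 / Y ^ 4 := by
    rw [hYdef, ← pow_mul, ← pow_mul, mul_comm K 4, ← one_div_pow]
    norm_num
  rw [hτ]
  by_cases h : 4 / 5 ≤ a
  · have h1 : 10 / 3 ≤ Y := by
      have : 10 / 3 ≤ 4 / (2 - a) := by
        rw [le_div_iff₀ h2a]
        linarith
      linarith
    have h2 : 1 / Y ^ 4 ≤ 1 / (10 / 3) ^ 4 :=
      one_div_le_one_div_of_le (by positivity) (pow_le_pow_left₀ (by norm_num) h1 4)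
    have h3 : 1 / (10 / 3 : ℝ) ^ 4 = 81 / 10000 := by norm_num
    rw [h3] at h2
    constructor <;> nlinarith
  · have h1 : 3000 / a ^ 4 ≤ Y := by
      refine le_trans ?_ hY
      have h3 : (9 / 25) / a ^ 4 ≤ (1 - a ^ 2) / (a ^ 4 * (1 - a / 2) ^ 2) := by
        refine div_le_div₀ h1a (by nlinarith) (by positivity) ?_
        refine mul_le_of_le_one_right (by positivity) ?_
        exact pow_le_one₀ hr.le (by linarith)
      have h4 : 3000 / a ^ 4 = 3000 / (9 / 25) * (9 / 25 / a ^ 4) := by ring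
      have h5 : 0 ≤ 9 / 25 / a ^ 4 := by positivity
      rw [h4]
      norm_num at h3 h5 ⊢
      nlinarith
    have ha4 : a ^ 4 ≤ 1 := pow_le_one₀ ha0.le ha1
    have hY1 : 1 ≤ Y := by
      refine le_trans ?_ h1
      rw [le_div_iff₀ (by positivity)]
      linarith
    have h2 : 1 / Y ^ 4 ≤ a ^ 4 / 3000 := by
      have h3 : 1 / Y ^ 4 ≤ 1 / Y :=
        one_div_le_one_div_of_le hY0 (le_self_pow₀ hY1 (by norm_num))
      have h4 : 1 / Y ≤ 1 / (3000 / a ^ 4) := one_div_le_one_div_of_le (by positivity) h1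
      rw [one_div_div] at h4
      linarith
    have h3 : a ^ 4 ≤ a ^ 2 := pow_le_pow_of_le_one ha0.le ha1 (by norm_num)
    constructor <;> nlinarith

theorem numStages_le {μ σ : ℝ} (hμ : 0 < μ) (hσ : 0 ≤ σ) :
    (numStages μ σ : ℝ) ≤ 101 + 18 * Real.log (1 + σ / μ) := by
  have hq := ratio_pos hμ hσ
  have hl : 0 < μ + σ := by linarith
  obtain ⟨a, ha⟩ : ∃ a, √(ratio μ σ) = a := ⟨_, rfl⟩
  have ha2 : a ^ 2 = ratio μ σ := by rw [← ha, Real.sq_sqrt hq.le]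
  have ha0 : 0 < a := ha ▸ Real.sqrt_pos.2 hq
  have ha1 : a ≤ 1 := by
    rw [← ha]
    exact Real.sqrt_le_one.2 (ratio_le_one hμ hσ)
  set s := 1 + σ / μ with hs
  have hs1 : 1 ≤ s := by
    have : 0 ≤ σ / μ := by positivity
    linarith
  have has : 1 / a ^ 2 = s := by
    rw [ha2, ratio, hs]
    field_simp
  have hr : 1 / 2 ≤ 1 - a / 2 := by linarith
  set X := 4 / (2 - a) + 10368 * ((1 - a ^ 2) / (a ^ 4 * (1 - a / 2) ^ 2)) with hX
  have h1 : 4 / (2 - a) ≤ 4 := div_le_self (by norm_num) (by linarith)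
  have h2 : (1 - a ^ 2) / (a ^ 4 * (1 - a / 2) ^ 2) ≤ 4 * s ^ 2 := by
    have h3 : 4 * s ^ 2 = 1 / (a ^ 4 * (1 / 2) ^ 2) := by
      rw [← has]
      field_simp
      norm_num
    rw [h3]
    refine div_le_div₀ zero_le_one (by nlinarith) (by positivity) ?_
    exact mul_le_mul_of_nonneg_left (pow_le_pow_left₀ (by norm_num) hr 2) (by positivity)
  have hX2 : 2 ≤ X := by
    have h3 : 2 ≤ 4 / (2 - a) := by
      rw [le_div_iff₀ (by linarith)]
      linarith
    have h4 : 0 ≤ (1 - a ^ 2) / (a ^ 4 * (1 - a / 2) ^ 2) :=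
      div_nonneg (by nlinarith) (by positivity)
    linarith
  -- `X ≤ 4 + 41472 s²` and `s ≥ 1`. With `1/log(9/8) ≤ 9` this gives `9·16·log 2 + 1 < 101` and the
  -- coefficient 18.
  have hX3 : X ≤ 2 ^ 16 * s ^ 2 := by nlinarith
  have hlogX : Real.log X ≤ 16 * Real.log 2 + 2 * Real.log s := by
    refine (Real.log_le_log (by linarith) hX3).trans ?_
    rw [Real.log_mul (by norm_num) (by positivity), Real.log_pow, Real.log_pow]
    norm_num
  have hlog : 1 / 9 ≤ Real.log (9 / 8) := by
    have := Real.one_sub_inv_le_log_of_pos (show (0 : ℝ) < 9 / 8 by norm_num)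
    norm_num at this ⊢
    exact this
  have hlogX0 : 0 ≤ Real.log X := Real.log_nonneg (by linarith)
  have h5 : 1 / Real.log (9 / 8) ≤ 9 := by
    rw [div_le_iff₀ (by linarith)]
    linarith
  have h6 : (numStages μ σ : ℝ) < 1 / Real.log (9 / 8) * Real.log X + 1 := by
    rw [numStages, ha, stage_argument_eq hμ hσ ha]
    exact Nat.ceil_lt_add_one (mul_nonneg (by positivity) hlogX0)
  have h7 := mul_le_mul_of_nonneg_right h5 hlogX0
  have h8 := Real.log_two_lt_d9
  linarith

theorem rate_pow_le {a : ℝ} (ha1 : a ≤ 1) (P : ℕ) :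
    (1 - a / 2) ^ P ≤ Real.exp (-(a * P / 2)) := by
  have h1 : 1 - a / 2 ≤ Real.exp (-(a / 2)) := by
    have := Real.add_one_le_exp (-(a / 2))
    linarith
  refine (pow_le_pow_left₀ (by linarith) h1 P).trans_eq ?_
  rw [← Real.exp_nat_mul]
  congr 1
  ring

end DASVRG

end

/-! ### Assembly of the estimates with the prescribed parameters -/

theorem mainTheorem4 :
    ∃ c : ℝ, 0 < c ∧
      -- the number of stages is of logarithmic order
      (∀ μ σ : ℝ, 0 < μ → 0 ≤ σ →
        (DASVRG.numStages μ σ : ℝ) ≤ c * (1 + Real.log (1 + σ / μ)) ∧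
        (μ ≤ σ → (DASVRG.numStages μ σ : ℝ) ≤ c * Real.log (1 + σ / μ))) ∧
      ∀ (d N m n C : ℕ) [NeZero N] (f : Fin N → DASVRG.Vec d → ℝ) (L μ σ η : ℝ)
        (x0 xstar : DASVRG.Vec d) (T K : ℕ),
        N = m * n → n < C →
        0 < L → 0 < μ → 0 ≤ σ →
        (∀ i, ConvexOn ℝ Set.univ (f i)) →
        (∀ i, DASVRG.IsSmooth L (f i)) →
        DASVRG.GradExpanding μ (DASVRG.objective f) →
        (∀ x, DASVRG.objective f xstar ≤ DASVRG.objective f x) →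
        ((η = 1 / (16 * L) ∧ σ ≤ 15 * L) ∨ η = 1 / (16 * (L + σ))) →
        T = DASVRG.stageLength L μ σ →
        K = DASVRG.numStages μ σ →
        -- accuracy of the solution of every proximal subproblem
        (∀ P : ℕ, T * K * P ≤ (C - n) * m → ∀ p : ℕ, 1 ≤ p → p ≤ P →
          DASVRG.expect (DASVRG.run f μ σ η m n (C - n) T K (T * K * P) x0 p)
              (fun s => DASVRG.proxObjective f σ s.xhat s.yPrev - DASVRG.proxMin f σ s.yPrev)
            ≤ 2 / 9 * (DASVRG.objective f x0 - DASVRG.objective f xstar)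
                * (1 - √(DASVRG.ratio μ σ) / 2) ^ p) ∧
        -- number of outer iterations for any target accuracy
        (∀ ε : ℝ, 0 < ε → ∀ P : ℕ, T * K * P ≤ (C - n) * m →
          c * √((μ + σ) / μ) *
              Real.log (c * ((μ + σ) / μ) *
                (DASVRG.objective f x0 - DASVRG.objective f xstar) / ε) ≤ (P : ℝ) →
          DASVRG.expect (DASVRG.run f μ σ η m n (C - n) T K (T * K * P) x0 P)
              (fun s => DASVRG.objective f s.xhat - DASVRG.objective f xstar) ≤ ε) ∧
        -- number of outer iterations for small target accuracies
        (∀ ε : ℝ, 0 < ε → ε ≤ 1 / 2 →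
          ε * (1 + (DASVRG.objective f x0 - DASVRG.objective f xstar)) ≤ μ / (μ + σ) →
          ∀ P : ℕ, T * K * P ≤ (C - n) * m →
          c * √((μ + σ) / μ) * Real.log (1 / ε) ≤ (P : ℝ) →
          DASVRG.expect (DASVRG.run f μ σ η m n (C - n) T K (T * K * P) x0 P)
              (fun s => DASVRG.objective f s.xhat - DASVRG.objective f xstar) ≤ ε) := by
  refine ⟨1000, by norm_num, fun μ σ hμ hσ => ?_, ?_⟩
  · have h1 := DASVRG.numStages_le hμ hσ
    have h2 : 0 ≤ σ / μ := by positivity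
    have h3 : 0 ≤ Real.log (1 + σ / μ) := Real.log_nonneg (by linarith)
    refine ⟨by linarith, fun h => ?_⟩
    have h4 : Real.log 2 ≤ Real.log (1 + σ / μ) := by
      have : 1 ≤ σ / μ := (one_le_div hμ).2 h
      exact Real.log_le_log (by norm_num) (by linarith)
    have := Real.log_two_gt_d9
    linarith
  intro d N m n C _ f L μ σ η x0 xs T K hN hC hL hμ hσ hconv hsm hexp hxs hη hTdef hKdef
  have hf : DASVRG.IsRegular f L μ := ⟨hL, hμ, hconv, hsm, hexp⟩
  have hl : 0 < μ + σ := by linarith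
  have hLσ : 0 < L + σ := by linarith
  have hη0 : 0 < η := by
    rcases hη with ⟨rfl, -⟩ | rfl <;> positivity
  -- In the case of step length `1/(16L)` this is where `σ ≤ 15L` is needed.
  have hη1 : η * (L + σ) ≤ 1 := by
    rcases hη with ⟨rfl, h⟩ | rfl
    · rw [div_mul_eq_mul_div, one_mul, div_le_one (by positivity)]
      linarith
    · rw [div_mul_eq_mul_div, one_mul, div_le_one (by positivity)]
      linarith
  have hη2 : η * L ≤ 1 / 16 := by
    rcases hη with ⟨rfl, h⟩ | rfl
    · rw [div_mul_eq_mul_div, one_mul, div_le_iff₀ (by positivity)]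
      linarith
    · rw [div_mul_eq_mul_div, one_mul, div_le_iff₀ (by positivity)]
      linarith
  have hη3 : 1 / 16 ≤ η * (L + σ) := by
    rcases hη with ⟨rfl, h⟩ | rfl
    · rw [div_mul_eq_mul_div, one_mul, le_div_iff₀ (by positivity)]
      linarith
    · rw [div_mul_eq_mul_div, one_mul, le_div_iff₀ (by positivity)]
      linarith
  have hTle : 96 * ((L + σ) / (μ + σ)) ≤ (T : ℝ) := hTdef ▸ Nat.le_ceil _
  have hT0 : 0 < T := by
    have : (0 : ℝ) < T := lt_of_lt_of_le (by positivity) hTle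
    exact_mod_cast this
  have hT : μ ≤ L → 96 ≤ T := by
    intro h
    have h1 : 1 ≤ (L + σ) / (μ + σ) := (one_le_div hl).2 (by linarith)
    have h2 : (96 : ℝ) ≤ T := by linarith
    exact_mod_cast h2
  have hTη : 6 ≤ η * T * (μ + σ) := by
    rw [mul_div_assoc', div_le_iff₀ hl] at hTle
    have := mul_le_mul_of_nonneg_left hTle hη0.le
    linarith
  obtain ⟨a, ha⟩ : ∃ a, √(DASVRG.ratio μ σ) = a := ⟨_, rfl⟩
  have hq := DASVRG.ratio_pos hμ hσ
  have ha0 : 0 < a := ha ▸ Real.sqrt_pos.2 hq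
  have ha2 : a ^ 2 = DASVRG.ratio μ σ := by rw [← ha, Real.sq_sqrt hq.le]
  have ha1 : a ≤ 1 := by
    rw [← ha]
    exact Real.sqrt_le_one.2 (DASVRG.ratio_le_one hμ hσ)
  have hr : 0 < 1 - a / 2 := by linarith
  obtain ⟨hK1, hK2⟩ := DASVRG.stage_contraction hμ hσ ha
  rw [← hKdef] at hK1 hK2
  set Δ := DASVRG.objective f x0 - DASVRG.objective f xs with hΔ
  have hΔ0 : 0 ≤ Δ := sub_nonneg.2 (hxs x0)
  have hW : DASVRG.outerLyapunov f μ a xs x0 x0 ≤ 2 * Δ := hf.outerLyapunov_initial_le hxs x0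
  have hnt : 0 < C - n := by omega
  have hfinal : ∀ P : ℕ,
      DASVRG.expect (DASVRG.run f μ σ η m n (C - n) T K (T * K * P) x0 P)
        (fun s => DASVRG.objective f s.xhat - DASVRG.objective f xs) ≤
      2 * Δ * Real.exp (-(a * P / 2)) := by
    intro P
    rw [DASVRG.expect_run hN hnt f μ σ η x0 le_rfl _
      (fun s => DASVRG.objective f s.1 - DASVRG.objective f xs) fun s => rfl]
    have h1 := hf.expect_outerLyapunov_le hσ hη0 hη1 hη2 hT0 hT hTη hxs ha hK1 x0 P
    have h2 := (DASVRG.expect_mono (DASVRG.iidOuter DASVRG.fullGradient f μ σ η T K x0 P)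
      (DASVRG.iidOuter_support_finite _ _ _ _ _ _ _ _ _) fun s =>
      hf.objective_sub_le_outerLyapunov (a := a) (xs := xs) s.1 s.2.1).trans h1
    have h3 := DASVRG.rate_pow_le ha1 P
    calc _ ≤ _ := h2
      _ ≤ (1 - a / 2) ^ P * (2 * Δ) := mul_le_mul_of_nonneg_left hW (by positivity)
      _ ≤ Real.exp (-(a * P / 2)) * (2 * Δ) := mul_le_mul_of_nonneg_right h3 (by positivity)
      _ = _ := mul_comm _ _
  have hsq : √((μ + σ) / μ) = 1 / a := by
    rw [← ha, DASVRG.ratio, one_div, ← Real.sqrt_inv, inv_div]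
  have hqinv : (μ + σ) / μ = 1 / a ^ 2 := by rw [ha2, DASVRG.ratio, one_div_div]
  refine ⟨fun P hP p hp1 hpP => ?_, fun ε hε P hP hlog => ?_, fun ε hε hε2 hεΔ P hP hlog => ?_⟩
  · obtain ⟨p, rfl⟩ := Nat.exists_eq_add_of_le' hp1
    rw [DASVRG.expect_run hN hnt f μ σ η x0 (Nat.mul_le_mul_left _ hpP) _
      (fun s => DASVRG.proxObjective f σ s.1 s.2.2 - DASVRG.proxMin f σ s.2.2) fun s => rfl, ha]
    have h1 := hf.expect_prox_error_le hσ hη0 hη1 hη2 hT0 hT hTη hxs ha hK1 x0 p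
    refine h1.trans ?_
    have h2 : (0 : ℝ) ≤ (1 - a / 2) ^ p := by positivity
    calc _ ≤ ((8 / 9 : ℝ) ^ 4) ^ K * 3 * ((1 - a / 2) ^ p * (2 * Δ)) :=
          mul_le_mul_of_nonneg_left (mul_le_mul_of_nonneg_left hW h2) (by positivity)
      -- The second bound of `stage_contraction` supplies the missing power of `1 - a/2`, and `6/27
      -- = 2/9`.
      _ ≤ (1 - a / 2) / 27 * 3 * ((1 - a / 2) ^ p * (2 * Δ)) :=
          mul_le_mul_of_nonneg_right (by linarith) (by positivity)
      _ = _ := by ring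
  · refine (hfinal P).trans ?_
    rcases hΔ0.eq_or_lt with h0 | h0
    · rw [← h0]
      simpa using hε.le
    rw [hsq, hqinv] at hlog
    set Z := 1000 * (1 / a ^ 2) * Δ / ε with hZ
    have hZ0 : 0 < Z := by positivity
    have h1 : Real.exp (-(a * P / 2)) * Z ≤ 1 := by
      -- If `Z ≤ 1` the logarithm is nonpositive and the condition on `P` is empty, but the initial
      -- error is already small enough.
      rcases le_total Z 1 with h | h
      · exact mul_le_one₀ (Real.exp_le_one_iff.2 (by
          have : 0 ≤ a * P / 2 := by positivity
          linarith)) hZ0.le h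
      · have h2 : 0 ≤ Real.log Z := Real.log_nonneg h
        have h3 : 1000 * Real.log Z ≤ a * P := by
          have := mul_le_mul_of_nonneg_left hlog ha0.le
          have h4 : a * (1000 * (1 / a) * Real.log Z) = 1000 * Real.log Z := by field_simp
          linarith
        rw [← Real.exp_log hZ0, ← Real.exp_add, Real.exp_le_one_iff]
        linarith
    have h2 : 2 * Δ = a ^ 2 * ε / 500 * Z := by
      rw [hZ]
      field_simp
      norm_num
    have h3 : a ^ 2 ≤ 1 := pow_le_one₀ ha0.le ha1
    calc 2 * Δ * Real.exp (-(a * P / 2)) =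
        a ^ 2 * ε / 500 * (Real.exp (-(a * P / 2)) * Z) := by rw [h2]; ring
      _ ≤ a ^ 2 * ε / 500 * 1 := mul_le_mul_of_nonneg_left h1 (by positivity)
      _ ≤ ε := by nlinarith
  · refine (hfinal P).trans ?_
    rw [hsq] at hlog
    have hlε : 0 ≤ Real.log (1 / ε) := Real.log_nonneg (by
      rw [le_div_iff₀ hε]
      linarith)
    have h1 : 1000 * Real.log (1 / ε) ≤ a * P := by
      have := mul_le_mul_of_nonneg_left hlog ha0.le
      have h4 : a * (1000 * (1 / a) * Real.log (1 / ε)) = 1000 * Real.log (1 / ε) := by field_simp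
      linarith
    -- One power of `ε` absorbs `Δ` through `εΔ ≤ 1`, one absorbs the factor 2 through `ε ≤ 1/2`,
    -- and one remains.
    have h2 : Real.exp (-(a * P / 2)) ≤ ε ^ 3 := by
      have h3 : ε ^ 3 = Real.exp (-(3 * Real.log (1 / ε))) := by
        rw [one_div, Real.log_inv, mul_neg, neg_neg, ← Real.exp_log (pow_pos hε 3), Real.log_pow]
        norm_num
      rw [h3, Real.exp_le_exp]
      linarith
    have h3 : ε * Δ ≤ 1 := by
      have := DASVRG.ratio_le_one hμ hσ
      unfold DASVRG.ratio at this
      linarith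
    calc 2 * Δ * Real.exp (-(a * P / 2)) ≤ 2 * Δ * ε ^ 3 :=
          mul_le_mul_of_nonneg_left h2 (by positivity)
      _ = (ε * Δ) * (2 * ε ^ 2) := by ring
      _ ≤ 1 * (2 * ε ^ 2) := mul_le_mul_of_nonneg_right h3 (by positivity)
      _ ≤ ε := by nlinarith
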